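/- Let $k$ be a commutative ring and let $(W,S)$ be a Coxeter system with Coxeter matrix $(m_{s,t})$. Let $B_W$ be its Artin braid group, with generators $g_s$ ($s\in S$) and relations $g_sg_tg_s\cdots=g_tg_sg_t\cdots$ ($m_{s,t}$ factors on each side, whenever $m_{s,t}<\infty$). For $w\in W$ with a reduced expression $w=s_1\cdots s_r$ put $g_w=g_{s_1}\cdots g_{s_r}\in B_W$; this does not depend on the choice of the reduced expression. Let $A$ be a commutative $k$-algebra, $\rho\colon W\to\mathrm{Aut}_{k\text{-alg}}(A)$ an action, and $a\colon S\to A^\times$ a map that is $W$-equivariant, i.e. $\rho_w(a_s)=a_{s'}$ whenever $s,s'\in S$ and $w\in W$ satisfy $wsw^{-1}=s'$. Let $B_W$ act on $A$ through the projection $B_W\to W$ and let $\mathcal E^{(W,S)}(A,\rho,a)$ be the quotient of the semidirect product $A\rtimes k[B_W]$ (in which $gc=(g.c)g$ for $g\in B_W$, $c\in A$) by the two-sided ideal generated by the elements $g_s^2-a_s-(1-a_s)g_s$, $s\in S$. (1) Suppose that $A$ is free of finite rank over $k$ and that $(1-a_s)(1-\rho_s)=0$ in $\mathrm{End}_k(A)$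 for all $s\in S$. Then $\mathcal E^{(W,S)}(A,\rho,a)$ is free over $k$, and for every $k$-basis $(c_i)_{i\in I}$ of $A$ the family $(c_ig_w)_{(i,w)\in I\times W}$ is a $k$-basis of it. If $k\neq0$, then $\mathrm{rk}_k\,\mathcal E^{(W,S)}(A,\rho,a)=|W|\cdot\mathrm{rk}_kA$ (as cardinal numbers). If $W$ is finite, then $\mathcal E^{(W,S)}(A,\rho,a)$ is a finitely generated $k$-module, hence free of finite rank, and for $k\ne 0$ the formula is one of natural numbers. (2) Let $W$ be finite and let $\Phi$ be the root system of $(W,S)$, i.e. the set of all $w.\alpha_s$ ($w\in W$, $s\in S$) in the standard geometric representation, where $\alpha_s$ is the simple root of $s$. A root subsystem is a subset of $\Phi$ that is stable under the reflections in its elements. The set $\Sigma(\Phi)$ of root subsystems is a commutative monoid, the product of two root subsystems being the root subsystem generated by their union, and $W$ acts on it. Let $u\colon S\to k^\times$ satisfy $u_s=u_{s'}$ whenever $s$ and $s'$ are conjugate in $W$, and let $\hat e_s=1+(u_s-1)\{\alpha_s,-\alpha_s\}\in k[\Sigma(\Phi)]^\times$. Let $\mathcal C_W=\mathcal E^{(W,S)}(k[\Sigma(\Phi)],\rho,\hat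 e)$, with $\rho$ the induced action of $W$ on the monoid algebra. Then $\mathcal C_W$ is free of finite rank over $k$ and, if $k\neq0$, its rank is $\mathrm{rk}_k\,\mathcal C_W=\mathrm{Bell}(W)\,|W|$, where $\mathrm{Bell}(W)$ is the number of reflection subgroups of $W$ (subgroups generated by reflections, i.e. by conjugates of elements of $S$). -/

import Mathlib

universe uk uB uW uA uI

noncomputable section

/-! ### Artin braid groups -/

namespace CoxeterMatrix

variable {B : Type*} (M : CoxeterMatrix B)

/-- The braid relations `s_i s_j s_i ⋯ = s_j s_i s_j ⋯` (`M i j` factors on each side), one for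
every pair of generators with `M i j ≠ ∞` (in Mathlib, `∞` is encoded as `0`). -/
def braidRelations : Set (FreeGroup B) :=
  {r | ∃ i j : B, M i j ≠ 0 ∧
    r = ((CoxeterSystem.braidWord M i j).map FreeGroup.of).prod *
      (((CoxeterSystem.braidWord M j i).map FreeGroup.of).prod)⁻¹}

/-- The Artin braid group `B_W` of a Coxeter matrix. -/
abbrev ArtinGroup : Type _ := PresentedGroup M.braidRelations

/-- The standard generator of the Artin braid group. -/
def artinGenerator (i : B) : M.ArtinGroup := PresentedGroup.of i

/-- The bilinear form `(e_i, e_j) ↦ -cos (π / m_ij)` on the real vector space with basis `B`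
(for `m_ij = ∞`, encoded as `0`, its value is `-1`). -/
def geomForm : (B →₀ ℝ) →ₗ[ℝ] (B →₀ ℝ) →ₗ[ℝ] ℝ :=
  Finsupp.linearCombination ℝ fun i =>
    Finsupp.linearCombination ℝ fun j => -Real.cos (Real.pi / (M i j : ℝ))

/-- The simple root attached to a generator. -/
def simpleRoot (_M : CoxeterMatrix B) (i : B) : B →₀ ℝ := Finsupp.single i 1

/-- The map `x ↦ x - 2 (v, x) v`, which is the reflection in `v` if `v` is a unit vector. -/
def reflectionIn (v : B →₀ ℝ) : (B →₀ ℝ) →ₗ[ℝ] (B →₀ ℝ) :=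
  Module.preReflection v ((2 : ℝ) • M.geomForm v)

theorem reflectionIn_apply (v x : B →₀ ℝ) :
    M.reflectionIn v x = x - (2 * M.geomForm v x) • v := by
  simp [reflectionIn, Module.preReflection_apply]

theorem geomForm_simpleRoot (i j : B) :
    M.geomForm (M.simpleRoot i) (M.simpleRoot j) = -Real.cos (Real.pi / (M i j : ℝ)) := by
  simp [geomForm, simpleRoot]

theorem geomForm_simpleRoot_self (i : B) :
    M.geomForm (M.simpleRoot i) (M.simpleRoot i) = 1 := by
  simp [geomForm_simpleRoot]

theorem geomForm_comm (x y : B →₀ ℝ) : M.geomForm x y = M.geomForm y x := by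
  have h : M.geomForm = M.geomForm.flip := by
    ext i j
    have := M.geomForm_simpleRoot i j
    have h2 := M.geomForm_simpleRoot j i
    simp only [simpleRoot] at this h2
    simp [this, h2, M.symmetric i j]
  exact congrArg (fun f => f x y) h

theorem two_smul_geomForm_simpleRoot (i : B) :
    ((2 : ℝ) • M.geomForm (M.simpleRoot i)) (M.simpleRoot i) = 2 := by
  simp [geomForm_simpleRoot_self]

/-- The reflection of the geometric representation attached to a generator. -/
def simpleReflection (i : B) : (B →₀ ℝ) ≃ₗ[ℝ] (B →₀ ℝ) :=
  Module.reflection (M.two_smul_geomForm_simpleRoot i)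

theorem simpleReflection_apply (i : B) (x : B →₀ ℝ) :
    M.simpleReflection i x = M.reflectionIn (M.simpleRoot i) x := rfl

open Polynomial.Chebyshev in
theorem simpleReflection_isLiftable : M.IsLiftable M.simpleReflection := by
  intro i j
  by_cases hij : i = j
  · subst hij
    rw [M.diagonal, pow_one]
    apply LinearEquiv.ext
    intro x
    rw [LinearEquiv.mul_apply]
    exact Module.involutive_reflection (M.two_smul_geomForm_simpleRoot i) x
  have hm1 : M i j ≠ 1 := M.off_diagonal i j hij
  apply LinearEquiv.ext
  intro z
  have hgf : ∀ a b : B, ((2 : ℝ) • M.geomForm (M.simpleRoot a)) (M.simpleRoot b) =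
      -2 * Real.cos (Real.pi / (M a b : ℝ)) := by
    intro a b
    simp [geomForm_simpleRoot]
  rcases Nat.lt_or_ge (M i j) 3 with hlt | hge
  · have h02 : M i j = 0 ∨ M i j = 2 := by omega
    rcases h02 with h0 | h2
    · rw [h0]; rfl
    · have key := Module.reflection_mul_reflection_pow_apply
        (M.two_smul_geomForm_simpleRoot i) (M.two_smul_geomForm_simpleRoot j) 2 z
      rw [h2]
      have e1 := hgf i j
      have e2 := hgf j i
      rw [M.symmetric j i] at e2
      simp only [h2, Nat.cast_ofNat, Real.cos_pi_div_two, mul_zero] at e1 e2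
      simp only [e1, e2] at key
      refine key.trans ?_
      norm_num
      abel
  · set m := M i j with hm
    have hm0 : (m : ℝ) ≠ 0 := by positivity
    set θ : ℝ := 2 * (Real.pi / m) with hθ
    have hsin : Real.sin θ ≠ 0 := by
      apply ne_of_gt
      apply Real.sin_pos_of_pos_of_lt_pi
      · positivity
      · have h3 : (3 : ℝ) ≤ m := by exact_mod_cast hge
        rw [hθ, ← mul_div_assoc, div_lt_iff₀ (by positivity)]
        nlinarith [Real.pi_pos]
    have ht : 2 * Real.cos θ = ((2 : ℝ) • M.geomForm (M.simpleRoot i)) (M.simpleRoot j) *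
        ((2 : ℝ) • M.geomForm (M.simpleRoot j)) (M.simpleRoot i) - 2 := by
      rw [hgf, hgf, M.symmetric j i, hθ, Real.cos_two_mul]
      ring
    have key := Module.reflection_mul_reflection_pow_apply
      (M.two_smul_geomForm_simpleRoot i) (M.two_smul_geomForm_simpleRoot j) m z _ ht
    refine key.trans ?_
    have hS : ∀ n : ℤ, (S ℝ n).eval (2 * Real.cos θ) = Real.sin ((n + 1) * θ) / Real.sin θ := by
      intro n
      rw [eq_div_iff hsin]
      exact S_two_mul_real_cos θ n
    have hmθ : (m : ℝ) * θ = 2 * Real.pi := by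
      rw [hθ]; field_simp
    have hodd : ∀ k : ℤ, (2 * k + 1 : ℝ) * θ = 2 * Real.pi →
        (S ℝ k).eval (2 * Real.cos θ) + (S ℝ (k - 1)).eval (2 * Real.cos θ) = 0 := by
      intro k hk
      rw [hS, hS, ← add_div]
      have : ((k : ℝ) + 1) * θ = 2 * Real.pi - k * θ := by linear_combination hk
      push_cast
      rw [this, Real.sin_two_pi_sub]
      simp
    have heven : ∀ k : ℤ, (2 * k : ℝ) * θ = 2 * Real.pi →
        (S ℝ (k - 1)).eval (2 * Real.cos θ) = 0 := by
      intro k hk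
      rw [hS]
      have : (((k - 1 : ℤ) : ℝ) + 1) * θ = Real.pi := by push_cast; linear_combination hk / 2
      rw [this]
      simp
    rcases Nat.even_or_odd' m with ⟨k, hk | hk⟩
    · have h1 : ((m : ℤ) - 2) / 2 = (k : ℤ) - 1 := by omega
      have h2 : ((m : ℤ) - 1) / 2 = (k : ℤ) - 1 := by omega
      have hz := heven k (by rw [← hmθ, hk]; push_cast; ring)
      rw [h1, h2, hz]
      simp
    · have h1 : ((m : ℤ) - 2) / 2 = (k : ℤ) - 1 := by omega
      have h2 : ((m : ℤ) - 1) / 2 = (k : ℤ) := by omega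
      have h3 : ((m : ℤ) - 3) / 2 = (k : ℤ) - 1 := by omega
      have h4 : (m : ℤ) / 2 = (k : ℤ) := by omega
      have hz := hodd k (by rw [← hmθ, hk]; push_cast; ring)
      rw [h1, h2, h3, h4, hz]
      simp

end CoxeterMatrix

/-! ### The geometric representation, the root system, and reflection subgroups -/

namespace CoxeterSystem

variable {B W : Type*} [Group W] {M : CoxeterMatrix B} (cs : CoxeterSystem M W)

/-- The standard geometric representation of a Coxeter system. -/
def geomRep : W →* ((B →₀ ℝ) ≃ₗ[ℝ] (B →₀ ℝ)) :=
  cs.lift ⟨M.simpleReflection, M.simpleReflection_isLiftable⟩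

theorem geomRep_simple (i : B) : cs.geomRep (cs.simple i) = M.simpleReflection i :=
  cs.lift_apply_simple M.simpleReflection_isLiftable i

/-- The root system `Φ` of a Coxeter system. -/
def roots : Set (B →₀ ℝ) := {α | ∃ (w : W) (i : B), α = cs.geomRep w (M.simpleRoot i)}

/-- The number of reflection subgroups of `W`, that is, of subgroups generated by reflections. -/
def bell : ℕ :=
  Nat.card {H : Subgroup W //
    ∃ T : Set W, (∀ t ∈ T, cs.IsReflection t) ∧ H = Subgroup.closure T}

/-- The projection of the Artin braid group onto the Coxeter group. -/
def artinProj : M.ArtinGroup →* W :=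
  PresentedGroup.toGroup (f := cs.simple) (by
    rintro r ⟨i, j, -, rfl⟩
    have h : ∀ ω : List B, FreeGroup.lift cs.simple ((ω.map FreeGroup.of).prod) =
        cs.wordProd ω := by
      intro ω
      rw [map_list_prod, List.map_map]
      simp [wordProd, Function.comp_def]
    rw [map_mul, map_inv, h, h, cs.wordProd_braidWord_eq i j, mul_inv_cancel])

/-- The canonical set-theoretical section `w ↦ g_w` of `artinProj`: the product of the generators
of the Artin braid group along a reduced expression for `w`. -/
def artinSection (w : W) : M.ArtinGroup :=
  ((cs.exists_isReduced w).choose.map M.artinGenerator).prod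

theorem geomForm_geomRep (w : W) (x y : B →₀ ℝ) :
    M.geomForm (cs.geomRep w x) (cs.geomRep w y) = M.geomForm x y := by
  induction w using cs.simple_induction_left generalizing x y with
  | one => simp
  | mul_simple_left w i ih =>
    rw [map_mul, LinearEquiv.mul_apply, LinearEquiv.mul_apply, geomRep_simple,
      CoxeterMatrix.simpleReflection_apply, CoxeterMatrix.simpleReflection_apply, ← ih x y,
      CoxeterMatrix.reflectionIn_apply, CoxeterMatrix.reflectionIn_apply]
    simp only [map_sub, map_smul, LinearMap.sub_apply, LinearMap.smul_apply, smul_eq_mul,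
      M.geomForm_simpleRoot_self, M.geomForm_comm _ (M.simpleRoot i)]
    ring

theorem geomRep_reflectionIn (w : W) (v x : B →₀ ℝ) :
    cs.geomRep w (M.reflectionIn v x) = M.reflectionIn (cs.geomRep w v) (cs.geomRep w x) := by
  simp only [CoxeterMatrix.reflectionIn_apply, map_sub, map_smul, geomForm_geomRep]

theorem geomForm_root_self {α : B →₀ ℝ} (hα : α ∈ cs.roots) : M.geomForm α α = 1 := by
  obtain ⟨w, i, rfl⟩ := hα
  rw [geomForm_geomRep, M.geomForm_simpleRoot_self]

theorem reflectionIn_root_self {α : B →₀ ℝ} (hα : α ∈ cs.roots) :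
    M.reflectionIn α α = -α := by
  rw [M.reflectionIn_apply, cs.geomForm_root_self hα]
  module

theorem geomRep_mem_roots (w : W) {α : B →₀ ℝ} (hα : α ∈ cs.roots) :
    cs.geomRep w α ∈ cs.roots := by
  obtain ⟨v, i, rfl⟩ := hα
  exact ⟨w * v, i, by rw [map_mul, LinearEquiv.mul_apply]⟩

theorem simpleRoot_mem_roots (i : B) : M.simpleRoot i ∈ cs.roots := ⟨1, i, by simp⟩

theorem reflectionIn_mem_roots {α β : B →₀ ℝ} (hα : α ∈ cs.roots) (hβ : β ∈ cs.roots) :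
    M.reflectionIn α β ∈ cs.roots := by
  obtain ⟨w, i, rfl⟩ := hα
  have h : M.reflectionIn (cs.geomRep w (M.simpleRoot i)) β =
      cs.geomRep (w * cs.simple i * w⁻¹) β := by
    rw [map_mul, map_mul, LinearEquiv.mul_apply, LinearEquiv.mul_apply, geomRep_simple,
      M.simpleReflection_apply, geomRep_reflectionIn, ← LinearEquiv.mul_apply, ← map_mul]
    simp
  rw [h]
  exact cs.geomRep_mem_roots _ hβ

theorem neg_mem_roots {α : B →₀ ℝ} (hα : α ∈ cs.roots) : -α ∈ cs.roots := by
  rw [← cs.reflectionIn_root_self hα]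
  exact cs.reflectionIn_mem_roots hα hα

/-- If `w s_i w⁻¹ = s_j`, then `w` maps the simple root of `i` to plus or minus that of `j`. -/
theorem geomRep_simpleRoot_eq {i j : B} {w : W} (h : w * cs.simple i * w⁻¹ = cs.simple j) :
    cs.geomRep w (M.simpleRoot i) = M.simpleRoot j ∨
      cs.geomRep w (M.simpleRoot i) = -M.simpleRoot j := by
  set α := cs.geomRep w (M.simpleRoot i) with hα
  have hαr : α ∈ cs.roots := cs.geomRep_mem_roots w (cs.simpleRoot_mem_roots i)
  have hj : M.reflectionIn (M.simpleRoot j) α = -α := by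
    rw [← M.simpleReflection_apply, ← cs.geomRep_simple, ← h, map_mul, map_mul,
      LinearEquiv.mul_apply, LinearEquiv.mul_apply, hα,
      ← LinearEquiv.mul_apply (cs.geomRep w⁻¹) (cs.geomRep w), ← map_mul cs.geomRep w⁻¹ w,
      inv_mul_cancel, map_one, LinearEquiv.coe_one, id, geomRep_simple,
      M.simpleReflection_apply, cs.reflectionIn_root_self (cs.simpleRoot_mem_roots i), map_neg]
  rw [M.reflectionIn_apply] at hj
  set c := M.geomForm (M.simpleRoot j) α with hc
  have hαc : α = c • M.simpleRoot j := by
    have h2 : (2 : ℝ) • α = (2 : ℝ) • (c • M.simpleRoot j) := by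
      rw [two_smul, smul_smul]
      nth_rewrite 1 [← neg_neg α]
      rw [← hj]
      abel
    exact smul_right_injective _ (two_ne_zero' ℝ) h2
  have hcc : c * c = 1 := by
    have h1 := cs.geomForm_root_self hαr
    rw [hαc] at h1
    simpa [M.geomForm_simpleRoot_self] using h1
  rcases mul_self_eq_one_iff.mp hcc with h1 | h1
  · left; rw [hαc, h1, one_smul]
  · right; rw [hαc, h1, neg_smul, one_smul]

/-! ### The monoid of root subsystems -/

/-- A root subsystem: a set of roots which is stable under the reflections in its elements. -/
@[ext]
structure RootSubsystem where
  carrier : Set (B →₀ ℝ)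
  subset_roots : carrier ⊆ cs.roots
  reflectionIn_mem : ∀ α ∈ carrier, ∀ β ∈ carrier, M.reflectionIn α β ∈ carrier

namespace RootSubsystem

variable {cs}

/-- The root subsystem generated by a set of roots (roots being all that is kept of the given
set). -/
def generated (X : Set (B →₀ ℝ)) : cs.RootSubsystem where
  carrier := {α | α ∈ cs.roots ∧
    ∀ Ψ : cs.RootSubsystem, X ∩ cs.roots ⊆ Ψ.carrier → α ∈ Ψ.carrier}
  subset_roots := fun _ hα => hα.1
  reflectionIn_mem := fun α hα β hβ =>
    ⟨cs.reflectionIn_mem_roots hα.1 hβ.1,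
      fun Ψ hΨ => Ψ.reflectionIn_mem α (hα.2 Ψ hΨ) β (hβ.2 Ψ hΨ)⟩

/-- The root subsystem `{α, -α}` attached to a simple root `α`. -/
def simple (i : B) : cs.RootSubsystem where
  carrier := {M.simpleRoot i, -M.simpleRoot i}
  subset_roots := by
    rintro α (rfl | rfl)
    · exact cs.simpleRoot_mem_roots i
    · exact cs.neg_mem_roots (cs.simpleRoot_mem_roots i)
  reflectionIn_mem := by
    have h := cs.reflectionIn_root_self (cs.simpleRoot_mem_roots i)
    have h' : ∀ x, M.reflectionIn (-M.simpleRoot i) x = M.reflectionIn (M.simpleRoot i) x := by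
      intro x
      simp [CoxeterMatrix.reflectionIn_apply]
    rintro α (rfl | rfl) β (rfl | rfl) <;> simp [h, h']

theorem generated_carrier_subset {X : Set (B →₀ ℝ)} {Ψ : cs.RootSubsystem}
    (h : X ⊆ Ψ.carrier) : (generated X : cs.RootSubsystem).carrier ⊆ Ψ.carrier :=
  fun _ hα => hα.2 Ψ (fun _ hx => h hx.1)

theorem subset_generated {X : Set (B →₀ ℝ)} (h : X ⊆ cs.roots) :
    X ⊆ (generated X : cs.RootSubsystem).carrier :=
  fun _ hα => ⟨h hα, fun _ hΨ => hΨ ⟨hα, h hα⟩⟩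

theorem le_antisymm' {Ψ Ψ' : cs.RootSubsystem} (h : Ψ.carrier ⊆ Ψ'.carrier)
    (h' : Ψ'.carrier ⊆ Ψ.carrier) : Ψ = Ψ' :=
  RootSubsystem.ext (Set.Subset.antisymm h h')

/-- The product of two root subsystems is the root subsystem generated by them. -/
instance : Mul cs.RootSubsystem := ⟨fun Ψ Ψ' => generated (Ψ.carrier ∪ Ψ'.carrier)⟩

instance : One cs.RootSubsystem := ⟨⟨∅, Set.empty_subset _, fun _ h => h.elim⟩⟩

theorem mul_def (Ψ Ψ' : cs.RootSubsystem) :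
    Ψ * Ψ' = generated (Ψ.carrier ∪ Ψ'.carrier) := rfl

theorem left_subset_mul (Ψ Ψ' : cs.RootSubsystem) : Ψ.carrier ⊆ (Ψ * Ψ').carrier :=
  Set.Subset.trans Set.subset_union_left
    (subset_generated (Set.union_subset Ψ.subset_roots Ψ'.subset_roots))

theorem right_subset_mul (Ψ Ψ' : cs.RootSubsystem) : Ψ'.carrier ⊆ (Ψ * Ψ').carrier :=
  Set.Subset.trans Set.subset_union_right
    (subset_generated (Set.union_subset Ψ.subset_roots Ψ'.subset_roots))

theorem mul_subset {Ψ Ψ' Ω : cs.RootSubsystem} (h : Ψ.carrier ⊆ Ω.carrier)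
    (h' : Ψ'.carrier ⊆ Ω.carrier) : (Ψ * Ψ').carrier ⊆ Ω.carrier :=
  generated_carrier_subset (Set.union_subset h h')

instance : CommMonoid cs.RootSubsystem where
  mul_assoc Ψ₁ Ψ₂ Ψ₃ := le_antisymm'
    (mul_subset
      (mul_subset (left_subset_mul _ _)
        ((left_subset_mul Ψ₂ Ψ₃).trans (right_subset_mul _ _)))
      ((right_subset_mul Ψ₂ Ψ₃).trans (right_subset_mul _ _)))
    (mul_subset ((left_subset_mul Ψ₁ Ψ₂).trans (left_subset_mul _ _))
      (mul_subset ((right_subset_mul Ψ₁ Ψ₂).trans (left_subset_mul _ _))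
        (right_subset_mul _ _)))
  one_mul Ψ := le_antisymm' (mul_subset (Set.empty_subset _) (Set.Subset.refl _))
    (right_subset_mul _ _)
  mul_one Ψ := le_antisymm' (mul_subset (Set.Subset.refl _) (Set.empty_subset _))
    (left_subset_mul _ _)
  mul_comm Ψ Ψ' := le_antisymm' (mul_subset (right_subset_mul _ _) (left_subset_mul _ _))
    (mul_subset (right_subset_mul _ _) (left_subset_mul _ _))

theorem mul_self_eq (Ψ : cs.RootSubsystem) : Ψ * Ψ = Ψ :=
  le_antisymm' (mul_subset (Set.Subset.refl _) (Set.Subset.refl _)) (left_subset_mul _ _)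

/-- The action of `W` on root subsystems induced by the geometric representation. -/
instance : SMul W cs.RootSubsystem where
  smul w Ψ :=
    { carrier := cs.geomRep w '' Ψ.carrier
      subset_roots := by
        rintro _ ⟨α, hα, rfl⟩
        exact cs.geomRep_mem_roots w (Ψ.subset_roots hα)
      reflectionIn_mem := by
        rintro _ ⟨α, hα, rfl⟩ _ ⟨β, hβ, rfl⟩
        rw [← geomRep_reflectionIn]
        exact ⟨_, Ψ.reflectionIn_mem α hα β hβ, rfl⟩ }

theorem smul_carrier (w : W) (Ψ : cs.RootSubsystem) :
    (w • Ψ).carrier = cs.geomRep w '' Ψ.carrier := rfl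

instance : MulAction W cs.RootSubsystem where
  one_smul Ψ := by
    apply RootSubsystem.ext
    simp [smul_carrier]
  mul_smul v w Ψ := by
    apply RootSubsystem.ext
    simp only [smul_carrier, Set.image_image]
    exact Set.image_congr fun x _ => by rw [map_mul, LinearEquiv.mul_apply]

theorem smul_mono (w : W) {Ψ Ψ' : cs.RootSubsystem} (h : Ψ.carrier ⊆ Ψ'.carrier) :
    (w • Ψ).carrier ⊆ (w • Ψ').carrier :=
  Set.image_mono h

instance : MulDistribMulAction W cs.RootSubsystem where
  smul_one w := by
    apply RootSubsystem.ext
    change _ '' (∅ : Set (B →₀ ℝ)) = ∅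
    simp
  smul_mul w Ψ Ψ' := by
    refine le_antisymm' ?_
      (mul_subset (smul_mono w (left_subset_mul _ _)) (smul_mono w (right_subset_mul _ _)))
    have h : (Ψ * Ψ').carrier ⊆ (w⁻¹ • (w • Ψ * w • Ψ')).carrier := by
      apply mul_subset
      · have := smul_mono w⁻¹ (left_subset_mul (w • Ψ) (w • Ψ'))
        rwa [inv_smul_smul] at this
      · have := smul_mono w⁻¹ (right_subset_mul (w • Ψ) (w • Ψ'))
        rwa [inv_smul_smul] at this
    have := smul_mono w h
    rwa [smul_inv_smul] at this

theorem smul_simple {i j : B} {w : W} (h : w * cs.simple i * w⁻¹ = cs.simple j) :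
    w • (simple i : cs.RootSubsystem) = simple j := by
  apply RootSubsystem.ext
  rw [smul_carrier]
  change _ '' {M.simpleRoot i, -M.simpleRoot i} = {M.simpleRoot j, -M.simpleRoot j}
  rw [Set.image_pair, map_neg]
  rcases cs.geomRep_simpleRoot_eq h with h | h
  · rw [h]
  · rw [h, neg_neg, Set.pair_comm]

end RootSubsystem

end CoxeterSystem

/-! ### Marin data and Marin algebras -/

/-- A Marin datum `((W,S),A,ρ,a)` over `k`: an action `ρ` of `W` on the commutative `k`-algebra `A`
by `k`-algebra automorphisms and a map `a` from the simple reflections to the units of `A`, which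
is equivariant: if `w s w⁻¹ = s'` for simple reflections `s`, `s'`, then `w.a_s = a_s'`. -/
structure MarinDatum (k : Type*) [CommRing k] {B W : Type*} [Group W] {M : CoxeterMatrix B}
    (cs : CoxeterSystem M W) (A : Type*) [CommRing A] [Algebra k A] where
  ρ : W →* (A ≃ₐ[k] A)
  a : B → Aˣ
  equivariant : ∀ (i j : B) (w : W), w * cs.simple i * w⁻¹ = cs.simple j →
    ρ w (a i : A) = (a j : A)

namespace MarinDatum

variable {k : Type*} [CommRing k] {B W : Type*} [Group W] {M : CoxeterMatrix B}
  {cs : CoxeterSystem M W} {A : Type*} [CommRing A] [Algebra k A] (D : MarinDatum k cs A)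

/-- The Artin braid group of `W`, as a type that carries the action on `A` given by the datum. -/
def BraidGroup (_D : MarinDatum k cs A) : Type _ := M.ArtinGroup

instance : Group D.BraidGroup := inferInstanceAs (Group M.ArtinGroup)

/-- The identity map from the Artin braid group to its copy carrying the action. -/
def toBraidGroup : M.ArtinGroup ≃* D.BraidGroup := MulEquiv.refl M.ArtinGroup

/-- The braid group acts on `A` through its projection to `W`. -/
instance : MulSemiringAction D.BraidGroup A :=
  MulSemiringAction.compHom A
    ((D.ρ.comp cs.artinProj).comp D.toBraidGroup.symm.toMonoidHom : D.BraidGroup →* (A ≃ₐ[k] A))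

theorem braidGroup_smul_def (g : D.BraidGroup) (c : A) :
    g • c = D.ρ (cs.artinProj (D.toBraidGroup.symm g)) c := rfl

instance : SMulCommClass D.BraidGroup k A where
  smul_comm g r c := by simp only [braidGroup_smul_def, map_smul]

/-- The semidirect product `A ⋊ k[B_W]`: the free left `A`-module on `B_W`, with multiplication
`(c g) (c' g') = c (g.c') g g'`. -/
abbrev SemidirectProduct : Type _ := SkewMonoidAlgebra A D.BraidGroup

/-- The inclusion of `A` in `A ⋊ k[B_W]`. -/
def inclA (c : A) : D.SemidirectProduct := SkewMonoidAlgebra.single (1 : D.BraidGroup) c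

/-- The inclusion of `B_W` in `A ⋊ k[B_W]`. -/
def inclB (g : M.ArtinGroup) : D.SemidirectProduct :=
  SkewMonoidAlgebra.single (D.toBraidGroup g) (1 : A)

/-- The relations `g_s ^ 2 = a_s + (1 - a_s) g_s`. -/
inductive Rel : D.SemidirectProduct → D.SemidirectProduct → Prop
  | quadratic (i : B) : Rel (D.inclB (M.artinGenerator i) ^ 2)
      (D.inclA (D.a i) + D.inclA (1 - D.a i) * D.inclB (M.artinGenerator i))

/-- The Marin algebra: the quotient of `A ⋊ k[B_W]` by the two-sided ideal generated by the
elements `g_s ^ 2 - a_s - (1 - a_s) g_s`. -/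
def Alg : Type _ := RingQuot D.Rel

instance : Ring D.Alg := inferInstanceAs (Ring (RingQuot D.Rel))

instance : Algebra k D.Alg := inferInstanceAs (Algebra k (RingQuot D.Rel))

/-- The quotient map `A ⋊ k[B_W] → 𝓔`. -/
def proj : D.SemidirectProduct →ₐ[k] D.Alg := RingQuot.mkAlgHom k D.Rel

/-- The image of an element of `A` in the Marin algebra. -/
def coeff (c : A) : D.Alg := D.proj (D.inclA c)

/-- The element `g_w` of the Marin algebra. -/
def g (w : W) : D.Alg := D.proj (D.inclB (cs.artinSection w))

/-- The Marin datum on the monoid algebra `k[E]` attached to an action of `W` on a commutative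
monoid `E`, an equivariant family `e` of idempotents of `E`, and an equivariant family `u` of units
of `k` (with trivial action); the units are `1 + (u_s - 1) e_s`. -/
def ofMonoid (cs : CoxeterSystem M W) (E : Type*) [CommMonoid E] [MulDistribMulAction W E]
    (e : B → E) (he : ∀ i, e i * e i = e i)
    (he' : ∀ (i j : B) (w : W), w * cs.simple i * w⁻¹ = cs.simple j → w • e i = e j)
    (u : B → kˣ)
    (hu : ∀ (i j : B) (w : W), w * cs.simple i * w⁻¹ = cs.simple j → u i = u j) :
    MarinDatum k cs (MonoidAlgebra k E) where
  ρ := MonoidAlgebra.domCongrAut.comp (MulDistribMulAction.toMulAut W E)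
  a := fun i =>
    { val := 1 + MonoidAlgebra.single (e i) ((u i : k) - 1)
      inv := 1 + MonoidAlgebra.single (e i) (((u i)⁻¹ : kˣ) - 1 : k)
      val_inv := by
        rw [add_mul, one_mul, mul_add, mul_one, MonoidAlgebra.single_mul_single, he, add_assoc, ← MonoidAlgebra.single_add, ← MonoidAlgebra.single_add]
        have : ((((u i)⁻¹ : kˣ) : k) - 1 + (((u i : k) - 1) +
          ((u i : k) - 1) * ((((u i)⁻¹ : kˣ) : k) - 1))) = 0 := by
          linear_combination (u i).mul_inv
        rw [this]
        simp
      inv_val := by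
        rw [add_mul, one_mul, mul_add, mul_one, MonoidAlgebra.single_mul_single, he, add_assoc, ← MonoidAlgebra.single_add, ← MonoidAlgebra.single_add]
        have : ((u i : k) - 1 + (((((u i)⁻¹ : kˣ) : k) - 1) +
          ((((u i)⁻¹ : kˣ) : k) - 1) * ((u i : k) - 1))) = 0 := by
          linear_combination (u i).mul_inv
        rw [this]
        simp }
  equivariant := by
    intro i j w h
    simp [he' i j w h, hu i j w h]

end MarinDatum

/-- The Marin datum that defines Marin's algebra `𝒞_W` over `k`, with parameters `u_s`: it is given
by the action of `W` on the monoid of root subsystems of its root system and by `s ↦ {α_s, -α_s}`. -/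
def CoxeterSystem.marinDatum {k : Type*} [CommRing k] {B W : Type*} [Group W]
    {M : CoxeterMatrix B} (cs : CoxeterSystem M W) (u : B → kˣ)
    (hu : ∀ (i j : B) (w : W), w * cs.simple i * w⁻¹ = cs.simple j → u i = u j) :
    MarinDatum k cs (MonoidAlgebra k cs.RootSubsystem) :=
  MarinDatum.ofMonoid cs cs.RootSubsystem CoxeterSystem.RootSubsystem.simple
    (fun _ => CoxeterSystem.RootSubsystem.mul_self_eq _)
    (fun _ _ _ h => CoxeterSystem.RootSubsystem.smul_simple h) u hu

end

noncomputable section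

namespace CoxeterSystem

variable {B W : Type*} [Group W] {M : CoxeterMatrix B} (cs : CoxeterSystem M W)

/-! ### Positivity of roots -/

/-! Part (1) has a spanning half and an independence half. Spanning is formal: the `A`-span of the
`g_w` contains `1` and is stable under left multiplication by `A`, by each `g_s` (through `g_s ^ 2 =
a_s + (1 - a_s) g_s` when `s` is a left descent) and by each `g_s⁻¹`, which exists in that span
because `a_s` is a unit.

For independence one builds the regular representation on the free `A`-module with basis `W`. The
formulas expected for left and right multiplication by `g_s` define operators `leftOp` and
`rightOp`. The hypothesis `(1 - a_s)(1 - ρ_s) = 0` gives the quadratic relation and makes every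
`leftOp` commute with every `rightOp`. The delicate point of the commutation is a Coxeter fact: left
multiplication by `s` can change whether `t` is a right descent of `w` only if `s w = w t`, and in
that case equivariance of `a` identifies the two coefficients. A product of left operators is then
determined by its value at the basis vector of `1`, so reduced words of the same element give the
same operator. Braid words are reduced, hence the braid relations hold, the Marin algebra acts, and
evaluation at the basis vector of `1` sends `c g_w` to `c` times the basis vector of `w`.

The Coxeter facts, including Matsumoto's theorem, come from the geometric representation: `w` maps
the simple root of `s` to a nonnegative vector exactly when `s` is not a right descent of `w`.

For (2), the subsystem `{α_s, -α_s}` absorbs the action of `s`, so part (1) applies to the monoid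
algebra. It remains to match root subsystems with reflection subgroups. The point is that a
reflection in the group generated by the reflections of `Ψ` has its roots in `Ψ`. Otherwise some
linear form kills such a root `β` but no element of `Ψ`. The sign that counts elements of `Ψ` made
negative agrees with `(-1) ^ length` on this group, yet the reflection in `β` preserves the form and
has odd length. -/

theorem exists_dihedral_sequence {i j : B} (hij : i ≠ j) :
    ∃ u : ℕ → ℝ, u 0 = 0 ∧ u 1 = 1 ∧
      (∀ n, u (n + 2) = 2 * Real.cos (Real.pi / (M i j : ℝ)) * u (n + 1) - u n) ∧
      ∀ n, M i j = 0 ∨ n ≤ M i j → 0 ≤ u n := by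
  by_cases h0 : M i j = 0
  -- For `m = ∞`, encoded as `0`, division by zero gives `cos (π / 0) = 1`, the correct parameter;
  -- the recurrence becomes that of an arithmetic progression.
  · refine ⟨fun n => n, by simp, by simp, fun n => ?_, fun n _ => by positivity⟩
    simp only [h0, Nat.cast_zero, div_zero, Real.cos_zero]
    push_cast
    ring
  · have h2 : (2 : ℝ) ≤ M i j := by
      have := M.off_diagonal i j hij
      exact_mod_cast (show 2 ≤ M i j by omega)
    set θ : ℝ := Real.pi / (M i j : ℝ) with hθ
    have hθ0 : 0 < θ := div_pos Real.pi_pos (by linarith)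
    have hmθ : (M i j : ℝ) * θ = Real.pi := by
      rw [hθ]
      field_simp
    have hsin : 0 < Real.sin θ :=
      Real.sin_pos_of_pos_of_lt_pi hθ0 (by nlinarith)
    -- These are the Chebyshev values `sin (nθ) / sin θ`, nonnegative as long as `nθ ≤ π`, that is
    -- `n ≤ m`.
    refine ⟨fun n => Real.sin (n * θ) / Real.sin θ, by simp, by simp [hsin.ne'], fun n => ?_,
      fun n hn => ?_⟩
    · have e1 : ((n + 2 : ℕ) : ℝ) * θ = ((n + 1 : ℕ) : ℝ) * θ + θ := by push_cast; ring
      have e2 : (n : ℝ) * θ = ((n + 1 : ℕ) : ℝ) * θ - θ := by push_cast; ring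
      beta_reduce
      rw [e1, e2, Real.sin_add, Real.sin_sub]
      field_simp
      ring
    · have hn' : (n : ℝ) ≤ M i j := by exact_mod_cast hn.resolve_left h0
      exact div_nonneg (Real.sin_nonneg_of_nonneg_of_le_pi (by positivity) (by nlinarith)) hsin.le

theorem geomRep_simple_apply (i : B) (x : B →₀ ℝ) :
    cs.geomRep (cs.simple i) x = x - (2 * M.geomForm (M.simpleRoot i) x) • M.simpleRoot i := by
  rw [geomRep_simple, M.simpleReflection_apply, M.reflectionIn_apply]

theorem geomRep_simple_simpleRoot_self (i : B) :
    cs.geomRep (cs.simple i) (M.simpleRoot i) = -M.simpleRoot i := by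
  rw [geomRep_simple, M.simpleReflection_apply,
    cs.reflectionIn_root_self (cs.simpleRoot_mem_roots i)]

/-- Each new letter changes only one of the two coordinates, and it does so by the recurrence for
`u`; the parity of `k` records which coordinate changes next. -/
theorem geomRep_alternatingWord {s t : B} {u : ℕ → ℝ} (h0 : u 0 = 0) (h1 : u 1 = 1)
    (h2 : ∀ n, u (n + 2) = 2 * Real.cos (Real.pi / (M s t : ℝ)) * u (n + 1) - u n) (k : ℕ) :
    cs.geomRep (cs.wordProd (alternatingWord s t k)) (M.simpleRoot s) =
      if Even k then u (k + 1) • M.simpleRoot s + u k • M.simpleRoot t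
      else u k • M.simpleRoot s + u (k + 1) • M.simpleRoot t := by
  induction k with
  | zero => simp [alternatingWord, h0, h1]
  | succ k ih =>
    rw [alternatingWord_succ', wordProd_cons, map_mul, LinearEquiv.mul_apply, ih]
    by_cases hk : Even k
    · have hk' : ¬ Even (k + 1) := by simpa [Nat.even_add_one] using hk
      simp only [hk, hk', if_true, if_false]
      simp only [geomRep_simple_apply, map_add, map_smul, M.geomForm_simpleRoot,
        M.symmetric t s, h2, M.diagonal]
      norm_num
      module
    · have hk' : Even (k + 1) := by simpa [Nat.even_add_one] using hk
      simp only [hk, hk', if_true, if_false]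
      simp only [geomRep_simple_apply, map_add, map_smul, M.geomForm_simpleRoot,
        h2, M.diagonal]
      norm_num
      module

theorem simpleRoot_nonneg (i : B) : 0 ≤ M.simpleRoot i :=
  Finsupp.single_nonneg.mpr zero_le_one

theorem simpleRoot_ne_zero (i : B) : M.simpleRoot i ≠ 0 := by
  simp [CoxeterMatrix.simpleRoot]

/-- If `t` is a right descent of `w` and `w` has no reduced expression ending with the braid word
of `s` and `t`, then `w` maps the simple root of `s` to a positive root, provided that this is
known for shorter elements not having `s` or `t` as a descent. -/
theorem geomRep_nonneg_of_isRightDescent {w : W} {s t : B} (hst : s ≠ t)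
    (ht : cs.IsRightDescent w t)
    (ih : ∀ v i, cs.length v < cs.length w → ¬ cs.IsRightDescent v i →
      0 ≤ cs.geomRep v (M.simpleRoot i))
    (hno : M s t ≠ 0 →
      cs.length (w * (cs.wordProd (braidWord M s t))⁻¹) + M s t ≠ cs.length w) :
    0 ≤ cs.geomRep w (M.simpleRoot s) := by
  classical
  -- The word `a k` alternates between `s` and `t`, has `k` letters and ends in `t`; `P k` says that
  -- it splits off on the right of `w` with lengths adding up. The longest such suffix is removed
  -- from `w`.
  set a : ℕ → W := fun k => cs.wordProd (alternatingWord s t k) with ha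
  set P : ℕ → Prop := fun k => cs.length (w * (a k)⁻¹) + k = cs.length w with hP
  have hal : ∀ k, cs.length (a k) ≤ k := fun k => by
    simpa using cs.length_wordProd_le (alternatingWord s t k)
  have has : ∀ k, a (k + 1) = cs.simple (if Even k then t else s) * a k := fun k => by
    simp only [ha]
    rw [alternatingWord_succ', wordProd_cons]
  have hlow : ∀ k, cs.length w ≤ cs.length (w * (a k)⁻¹) + k := fun k => by
    have := cs.length_mul_le (w * (a k)⁻¹) (a k)
    rw [inv_mul_cancel_right] at this
    have := hal k
    omega
  have hPs : ∀ k, P (k + 1) → P k := fun k hk => by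
    have h1 : w * (a k)⁻¹ = w * (a (k + 1))⁻¹ * cs.simple (if Even k then t else s) := by
      rw [has, mul_inv_rev, inv_simple]
      simp [mul_assoc]
    have h2 := cs.length_mul_le (w * (a (k + 1))⁻¹) (cs.simple (if Even k then t else s))
    rw [← h1, length_simple] at h2
    have := hlow k
    simp only [hP] at hk ⊢
    omega
  have hPle : ∀ k j, j ≤ k → P k → P j := fun k j hjk =>
    Nat.decreasingInduction (motive := fun j _ => P k → P j)
      (fun j _ h hk => hPs j (h hk)) (fun h => h) hjk
  have hP1 : P 1 := by
    have : a 1 = cs.simple t := by simp [ha, alternatingWord]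
    simp only [hP, this, inv_simple]
    exact (cs.isRightDescent_iff).mp ht
  have hbd : ∀ k, P k → k ≤ cs.length w := fun k hk => by simp only [hP] at hk; omega
  set k := Nat.findGreatest P (cs.length w) with hk
  have hk1 : 1 ≤ k := Nat.le_findGreatest (hbd 1 hP1) hP1
  have hPk : P k := Nat.findGreatest_spec (hbd 1 hP1) hP1
  have hnk : ¬ P (k + 1) := fun h => by
    have := Nat.le_findGreatest (hbd _ h) h
    omega
  have hkm : M s t = 0 ∨ k + 1 ≤ M s t := by
    by_contra! hc
    exact hno hc.1 (hPle k (M s t) (by omega) hPk)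
  have hvw : cs.length (w * (a k)⁻¹) < cs.length w := by simp only [hP] at hPk; omega
  -- This is the letter that would extend the suffix to length `k + 1`: maximality of `k` forbids it
  -- as a descent of the remaining factor.
  have hx : ¬ cs.IsRightDescent (w * (a k)⁻¹) (if Even k then t else s) := fun h => by
    apply hnk
    have := (cs.isRightDescent_iff).mp h
    simp only [hP] at hPk ⊢
    rw [has, mul_inv_rev, inv_simple, ← mul_assoc]
    omega
  -- This is the first letter of `a k`: giving it back to the left factor produces `w * (a (k -
  -- 1))⁻¹`, which is longer.
  have hy : ¬ cs.IsRightDescent (w * (a k)⁻¹) (if Even k then s else t) := fun h => by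
    obtain ⟨j, hj⟩ : ∃ j, k = j + 1 := ⟨k - 1, by omega⟩
    have h1 := hPs j (hj ▸ hPk)
    have h2 : w * (a k)⁻¹ * cs.simple (if Even k then s else t) = w * (a j)⁻¹ := by
      have : (if Even k then s else t) = if Even j then t else s := by
        rw [hj]
        by_cases hj2 : Even j <;> simp [hj2, Nat.even_add_one]
      rw [this, hj, has, mul_inv_rev, inv_simple]
      simp [mul_assoc]
    have := (cs.isRightDescent_iff).mp h
    rw [h2] at this
    simp only [hP] at h1 hPk
    omega
  have hs : 0 ≤ cs.geomRep (w * (a k)⁻¹) (M.simpleRoot s) := by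
    apply ih _ _ hvw
    by_cases h : Even k
    · simpa [h] using hy
    · simpa [h] using hx
  have ht : 0 ≤ cs.geomRep (w * (a k)⁻¹) (M.simpleRoot t) := by
    apply ih _ _ hvw
    by_cases h : Even k
    · simpa [h] using hx
    · simpa [h] using hy
  obtain ⟨u, h0, h1, h2, hu⟩ := exists_dihedral_sequence (M := M) hst
  have hw : cs.geomRep w (M.simpleRoot s) =
      cs.geomRep (w * (a k)⁻¹) (cs.geomRep (a k) (M.simpleRoot s)) := by
    rw [← LinearEquiv.mul_apply, ← map_mul, inv_mul_cancel_right]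
  have huk := hu k (by omega)
  have huk1 := hu (k + 1) hkm
  rw [hw, ha]
  dsimp only
  rw [cs.geomRep_alternatingWord h0 h1 h2]
  split_ifs <;> rw [map_add, map_smul, map_smul] <;>
    exact add_nonneg (smul_nonneg ‹_› ‹_›) (smul_nonneg ‹_› ‹_›)

theorem wordProd_braidWord_eq_mul_simple {s t : B} (h : M s t ≠ 0) :
    cs.wordProd (braidWord M s t) =
      cs.wordProd (alternatingWord s t (M s t - 1)) * cs.simple s := by
  rw [wordProd_braidWord_eq, ← wordProd_concat, ← alternatingWord_succ, braidWord,
    M.symmetric t s, Nat.sub_add_cancel (by omega)]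

/-- By induction on length, peeling off a rank-two suffix at some other descent `t`. The only
obstruction would be a full braid word at the end of `w`, but that element also has an expression
ending in `i`, which would make `i` a descent. -/
theorem geomRep_nonneg {w : W} {i : B} (h : ¬ cs.IsRightDescent w i) :
    0 ≤ cs.geomRep w (M.simpleRoot i) := by
  induction hn : cs.length w using Nat.strong_induction_on generalizing w i with
  | _ n ih =>
    by_cases hw : w = 1
    · subst hw
      simpa using simpleRoot_nonneg i
    obtain ⟨t, ht⟩ := cs.exists_rightDescent_of_ne_one hw
    have hit : i ≠ t := fun e => h (e ▸ ht)
    refine cs.geomRep_nonneg_of_isRightDescent hit ht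
      (fun v j hv hj => ih _ (hn ▸ hv) hj rfl) fun hM hl => h ?_
    have h1 : w * cs.simple i = w * (cs.wordProd (braidWord M i t))⁻¹ *
        cs.wordProd (alternatingWord i t (M i t - 1)) := by
      rw [cs.wordProd_braidWord_eq_mul_simple hM, mul_inv_rev, inv_simple]
      simp [mul_assoc]
    have h2 := cs.length_mul_le (w * (cs.wordProd (braidWord M i t))⁻¹)
      (cs.wordProd (alternatingWord i t (M i t - 1)))
    have h3 := cs.length_wordProd_le (alternatingWord i t (M i t - 1))
    rw [length_alternatingWord] at h3
    rw [← h1] at h2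
    unfold IsRightDescent
    omega

theorem geomRep_nonpos {w : W} {i : B} (h : cs.IsRightDescent w i) :
    cs.geomRep w (M.simpleRoot i) ≤ 0 := by
  have h1 := cs.geomRep_nonneg (cs.isRightDescent_iff_not_isRightDescent_mul.mp h)
  rw [map_mul, LinearEquiv.mul_apply, geomRep_simple_simpleRoot_self, map_neg] at h1
  exact neg_nonneg.mp h1

theorem not_isRightDescent_iff_nonneg {w : W} {i : B} :
    ¬ cs.IsRightDescent w i ↔ 0 ≤ cs.geomRep w (M.simpleRoot i) := by
  refine ⟨cs.geomRep_nonneg, fun h hc => ?_⟩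
  have h0 := le_antisymm (cs.geomRep_nonpos hc) h
  exact simpleRoot_ne_zero (M := M) i ((LinearEquiv.map_eq_zero_iff _).mp h0)

/-- A nontrivial element has a right descent and sends the corresponding simple root to a
nonpositive vector, so it does not act trivially. -/
theorem geomRep_injective : Function.Injective cs.geomRep := by
  rw [injective_iff_map_eq_one]
  intro w hw
  by_contra hne
  obtain ⟨i, hi⟩ := cs.exists_rightDescent_of_ne_one hne
  refine (cs.not_isRightDescent_iff_nonneg).mpr ?_ hi
  rw [hw]
  exact simpleRoot_nonneg (M := M) i

theorem simple_injective : Function.Injective cs.simple := by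
  intro i j h
  by_contra hij
  have h1 : cs.geomRep (cs.simple i) (M.simpleRoot i) = -M.simpleRoot i :=
    cs.geomRep_simple_simpleRoot_self i
  rw [h, geomRep_simple_apply] at h1
  have := DFunLike.congr_fun h1 i
  simp [CoxeterMatrix.simpleRoot, Ne.symm hij] at this
  linarith

theorem reflectionIn_geomRep_simpleRoot (w : W) (i : B) (x : B →₀ ℝ) :
    M.reflectionIn (cs.geomRep w (M.simpleRoot i)) x =
      cs.geomRep (w * cs.simple i * w⁻¹) x := by
  rw [map_mul, map_mul, LinearEquiv.mul_apply, LinearEquiv.mul_apply, geomRep_simple,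
    M.simpleReflection_apply, geomRep_reflectionIn, ← LinearEquiv.mul_apply, ← map_mul]
  simp

theorem mul_simple_mul_inv_eq_of_reflectionIn_eq {v w : W} {i j : B}
    (h : M.reflectionIn (cs.geomRep v (M.simpleRoot i)) =
      M.reflectionIn (cs.geomRep w (M.simpleRoot j))) :
    v * cs.simple i * v⁻¹ = w * cs.simple j * w⁻¹ := by
  apply cs.geomRep_injective
  ext1 x
  rw [← reflectionIn_geomRep_simpleRoot, ← reflectionIn_geomRep_simpleRoot, h]

/-- The reflection `s_i` changes only the coordinate at `i`. All other coordinates are thus both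
nonnegative and nonpositive, and the root has norm one. -/
theorem eq_simpleRoot_of_nonneg_of_nonpos {α : B →₀ ℝ} (hα : α ∈ cs.roots) {i : B}
    (h : 0 ≤ α) (h' : cs.geomRep (cs.simple i) α ≤ 0) : α = M.simpleRoot i := by
  classical
  have hz : ∀ x, x ≠ i → α x = 0 := fun x hx => by
    have h1 := h' x
    have h2 := h x
    rw [geomRep_simple_apply] at h1
    simp [CoxeterMatrix.simpleRoot, Ne.symm hx] at h1 h2
    exact le_antisymm h1 h2
  have hαi : α = α i • M.simpleRoot i := by
    ext x
    by_cases hx : x = i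
    · subst hx; simp [CoxeterMatrix.simpleRoot]
    · simp [CoxeterMatrix.simpleRoot, Ne.symm hx, hz x hx]
  have h1 := cs.geomForm_root_self hα
  rw [hαi] at h1
  simp only [map_smul, LinearMap.smul_apply, M.geomForm_simpleRoot_self, smul_eq_mul,
    mul_one] at h1
  have h2 : 0 ≤ α i := h i
  have : α i = 1 := by nlinarith
  rw [hαi, this, one_smul]

/-- If the descent status of `j` changes, then `s_i` changes the sign of the root `w α_j`, so this
root is `α_i` or `-α_i` and conjugation by `w` takes `s_j` to `s_i`. This separates the two cases in
the commutation of left and right operators. -/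
theorem simple_mul_eq_mul_simple_of_isRightDescent_ne {w : W} {i j : B}
    (h : ¬ (cs.IsRightDescent (cs.simple i * w) j ↔ cs.IsRightDescent w j)) :
    cs.simple i * w = w * cs.simple j := by
  have key : ∀ v : W, ¬ cs.IsRightDescent v j → cs.IsRightDescent (cs.simple i * v) j →
      cs.simple i * v = v * cs.simple j := fun v h1 h2 => by
    have h3 := cs.geomRep_nonneg h1
    have h4 := cs.geomRep_nonpos h2
    rw [map_mul, LinearEquiv.mul_apply] at h4
    have h5 := cs.eq_simpleRoot_of_nonneg_of_nonpos
      (cs.geomRep_mem_roots v (cs.simpleRoot_mem_roots j)) h3 h4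
    have h6 := cs.mul_simple_mul_inv_eq_of_reflectionIn_eq (v := v) (w := 1) (i := j) (j := i)
      (by rw [h5]; simp)
    simp only [one_mul, inv_one, mul_one] at h6
    rw [← h6]
    simp [mul_assoc]
  by_cases hw : cs.IsRightDescent w j
  · have h1 : ¬ cs.IsRightDescent (cs.simple i * w) j := fun hc => h (by simp [hc, hw])
    have := key _ h1 (by simpa using hw)
    rw [simple_mul_simple_cancel_left] at this
    nth_rewrite 2 [this]
    simp [mul_assoc]
  · have h1 : cs.IsRightDescent (cs.simple i * w) j := by
      by_contra hc
      exact h (by simp [hc, hw])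
    exact key w hw h1

theorem isLeftDescent_mul_simple_iff {w : W} {i j : B}
    (h : cs.simple i * w ≠ w * cs.simple j) :
    cs.IsLeftDescent (w * cs.simple j) i ↔ cs.IsLeftDescent w i := by
  by_contra hc
  rw [← isRightDescent_inv_iff, ← isRightDescent_inv_iff, mul_inv_rev, inv_simple] at hc
  have := cs.simple_mul_eq_mul_simple_of_isRightDescent_ne hc
  apply h
  have h2 := congrArg (fun x => x⁻¹) this
  simp only [mul_inv_rev, inv_simple, inv_inv] at h2
  exact h2.symm

theorem isRightDescent_simple_mul_iff {w : W} {i j : B}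
    (h : cs.simple i * w ≠ w * cs.simple j) :
    cs.IsRightDescent (cs.simple i * w) j ↔ cs.IsRightDescent w j := by
  by_contra hc
  exact h (cs.simple_mul_eq_mul_simple_of_isRightDescent_ne hc)

/-! ### Alternating words and Matsumoto's theorem -/

/-- Up to length `m`, each new letter is not a descent of the preceding word, because the
coefficients of the image of its simple root are terms of the nonnegative sequence `u`. -/
theorem isReduced_alternatingWord {i j : B} (hij : i ≠ j) {k : ℕ}
    (hk : M i j = 0 ∨ k ≤ M i j) : cs.IsReduced (alternatingWord i j k) := by
  induction k generalizing i j with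
  | zero => simp [IsReduced, alternatingWord]
  | succ k ih =>
    have hr := ih hij.symm (by rw [M.symmetric]; omega)
    have hd : ¬ cs.IsRightDescent (cs.wordProd (alternatingWord j i k)) j := by
      rw [not_isRightDescent_iff_nonneg]
      obtain ⟨u, h0, h1, h2, hu⟩ := exists_dihedral_sequence (M := M) hij.symm
      rw [M.symmetric] at hu
      have huk := hu k (by omega)
      have huk1 := hu (k + 1) hk
      rw [cs.geomRep_alternatingWord h0 h1 h2]
      split_ifs <;> exact add_nonneg (smul_nonneg ‹_› (simpleRoot_nonneg _))
        (smul_nonneg ‹_› (simpleRoot_nonneg _))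
    rw [not_isRightDescent_iff, hr.eq] at hd
    unfold IsReduced
    rw [alternatingWord_succ, wordProd_concat, hd]
    simp

theorem artin_braid {i j : B} (h : M i j ≠ 0) :
    ((braidWord M i j).map M.artinGenerator).prod =
      ((braidWord M j i).map M.artinGenerator).prod := by
  have key : ∀ ω : List B, (ω.map M.artinGenerator).prod =
      PresentedGroup.mk M.braidRelations ((ω.map FreeGroup.of).prod) := fun ω => by
    rw [map_list_prod, List.map_map]
    rfl
  rw [key, key, ← mul_inv_eq_one, ← map_inv, ← map_mul]
  exact (QuotientGroup.eq_one_iff _).mpr (Subgroup.subset_normalClosure ⟨i, j, h, rfl⟩)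

theorem isReduced_concat_iff {ω : List B} {i : B} :
    cs.IsReduced (ω.concat i) ↔
      cs.IsReduced ω ∧ ¬ cs.IsRightDescent (cs.wordProd ω) i := by
  unfold IsReduced
  rw [not_isRightDescent_iff, wordProd_concat, List.length_concat]
  have := cs.length_wordProd_le ω
  have := cs.length_mul_simple (cs.wordProd ω) i
  omega

/-- Matsumoto's theorem. -/
theorem artin_prod_eq_of_isReduced {ω ω' : List B} (h : cs.IsReduced ω) (h' : cs.IsReduced ω')
    (he : cs.wordProd ω = cs.wordProd ω') :
    (ω.map M.artinGenerator).prod = (ω'.map M.artinGenerator).prod := by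
  induction hn : ω.length using Nat.strong_induction_on generalizing ω ω' with
  | _ n ih =>
    have hlen : ω'.length = n := by rw [← hn, ← h.eq, ← h'.eq, he]
    -- With a common last letter, that letter cancels and induction on the length applies.
    have same : ∀ {ν ν' : List B} {i : B}, cs.IsReduced (ν.concat i) →
        cs.IsReduced (ν'.concat i) → cs.wordProd (ν.concat i) = cs.wordProd (ν'.concat i) →
        ν.length < n →
        ((ν.concat i).map M.artinGenerator).prod =
          ((ν'.concat i).map M.artinGenerator).prod := by
      intro ν ν' i h1 h2 h3 h4
      rw [wordProd_concat, wordProd_concat, mul_left_inj] at h3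
      have := ih _ h4 ((cs.isReduced_concat_iff).mp h1).1 ((cs.isReduced_concat_iff).mp h2).1
        h3 rfl
      simp only [List.concat_eq_append, List.map_append, List.prod_append, this]
    rcases List.eq_nil_or_concat ω with rfl | ⟨ν, s, rfl⟩
    · have : ω' = [] := List.length_eq_zero_iff.mp (by rw [hlen, ← hn]; rfl)
      rw [this]
    rcases List.eq_nil_or_concat ω' with rfl | ⟨ν', t, rfl⟩
    · simp at hn hlen; omega
    have hνn : ν.length < n := by simp at hn; omega
    have hνn' : ν'.length < n := by simp at hlen; omega
    by_cases hst : s = t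
    · subst hst
      exact same h h' he hνn
    have hs : cs.IsRightDescent (cs.wordProd (ν.concat s)) s := by
      rw [isRightDescent_iff, h.eq]
      have := ((cs.isReduced_concat_iff).mp h).1.eq
      rw [wordProd_concat, simple_mul_simple_cancel_right, this, List.length_concat]
    have ht : cs.IsRightDescent (cs.wordProd (ν.concat s)) t := by
      rw [he, isRightDescent_iff, h'.eq]
      have := ((cs.isReduced_concat_iff).mp h').1.eq
      rw [wordProd_concat, simple_mul_simple_cancel_right, this, List.length_concat]
    -- Both last letters are descents. If the braid word of `s` and `t` did not split off on the
    -- right, `w` would keep the simple root of `s` nonnegative, which a descent does not allow.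
    obtain ⟨hM, hl⟩ : M s t ≠ 0 ∧
        cs.length (cs.wordProd (ν.concat s) * (cs.wordProd (braidWord M s t))⁻¹) + M s t =
          cs.length (cs.wordProd (ν.concat s)) := by
      by_contra! hc
      refine cs.not_isRightDescent_iff_nonneg.mpr ?_ hs
      exact cs.geomRep_nonneg_of_isRightDescent hst ht (fun v i _ hv => cs.geomRep_nonneg hv) hc
    obtain ⟨μ, hμ, hμv⟩ := cs.exists_isReduced
      (cs.wordProd (ν.concat s) * (cs.wordProd (braidWord M s t))⁻¹)
    have hp : cs.wordProd (μ ++ braidWord M s t) = cs.wordProd (ν.concat s) := by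
      rw [wordProd_append, ← hμv, inv_mul_cancel_right]
    have hp' : cs.wordProd (μ ++ braidWord M t s) = cs.wordProd (ν.concat s) := by
      rw [wordProd_append, ← wordProd_braidWord_eq, ← wordProd_append, hp]
    have hlμ : μ.length + M s t = n := by
      rw [← hμ.eq, ← hμv, hl, h.eq, hn]
    have hr : cs.IsReduced (μ ++ braidWord M s t) := by
      unfold IsReduced
      rw [hp, h.eq, hn]
      simp [hlμ]
    have hr' : cs.IsReduced (μ ++ braidWord M t s) := by
      unfold IsReduced
      rw [hp', h.eq, hn]
      simp [← hlμ, M.symmetric t s]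
    have hc : μ ++ braidWord M s t = (μ ++ alternatingWord t s (M s t - 1)).concat t := by
      rw [List.concat_eq_append, List.append_assoc, ← List.concat_eq_append,
        ← alternatingWord_succ, braidWord, Nat.sub_add_cancel (by omega)]
    have hc' : μ ++ braidWord M t s = (μ ++ alternatingWord s t (M s t - 1)).concat s := by
      rw [List.concat_eq_append, List.append_assoc, ← List.concat_eq_append,
        ← alternatingWord_succ, braidWord, M.symmetric t s, Nat.sub_add_cancel (by omega)]
    rw [hc] at hr hp
    rw [hc'] at hr' hp'
    -- Each given word is compared with the reduced word through `μ` that has the same last letter;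
    -- these two intermediate words differ by one braid relation.
    have e1 := same h hr' hp'.symm hνn
    have e2 := same h' hr (he.symm.trans hp.symm) hνn'
    rw [e1, e2, ← hc, ← hc', List.map_append, List.map_append, List.prod_append,
      List.prod_append, artin_braid hM]

theorem artinSection_wordProd {ω : List B} (h : cs.IsReduced ω) :
    cs.artinSection (cs.wordProd ω) = (ω.map M.artinGenerator).prod :=
  cs.artin_prod_eq_of_isReduced (cs.exists_isReduced _).choose_spec.1 h
    (cs.exists_isReduced _).choose_spec.2.symm

theorem artinSection_one : cs.artinSection 1 = 1 := by
  simpa using cs.artinSection_wordProd (ω := []) (by simp [IsReduced])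

theorem artinSection_simple_mul {w : W} {i : B} (h : ¬ cs.IsLeftDescent w i) :
    cs.artinSection (cs.simple i * w) = M.artinGenerator i * cs.artinSection w := by
  obtain ⟨ω, hω, rfl⟩ := cs.exists_isReduced w
  rw [not_isLeftDescent_iff, hω.eq] at h
  rw [cs.artinSection_wordProd hω, ← wordProd_cons, cs.artinSection_wordProd]
  · simp
  · unfold IsReduced
    rw [wordProd_cons, h]
    simp

theorem artinProj_artinGenerator (i : B) : cs.artinProj (M.artinGenerator i) = cs.simple i :=
  PresentedGroup.toGroup.of _

end CoxeterSystem

namespace MarinDatum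

open CoxeterSystem

variable {k : Type*} [CommRing k] {B W : Type*} [Group W] {M : CoxeterMatrix B}
  {cs : CoxeterSystem M W} {A : Type*} [CommRing A] [Algebra k A] (D : MarinDatum k cs A)

/-! ### The regular representation of a Marin algebra -/

theorem rho_simple_a (i : B) : D.ρ (cs.simple i) (D.a i : A) = D.a i :=
  D.equivariant i i (cs.simple i) (by simp)

theorem rho_simple_rho_simple (i : B) (x : A) :
    D.ρ (cs.simple i) (D.ρ (cs.simple i) x) = x := by
  rw [← AlgEquiv.mul_apply, ← map_mul, cs.simple_mul_simple_self, map_one, AlgEquiv.one_apply]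

open scoped Classical in
/-- The left multiplication by the generator `g_s` on the free `A`-module with basis `g_w`. -/
def leftOp (i : B) : Module.End k (W →₀ A) :=
  Finsupp.lsum k fun w =>
    if cs.IsLeftDescent w i then
      Finsupp.lsingle (cs.simple i * w) ∘ₗ LinearMap.mulLeft k (D.a i : A) ∘ₗ
          (D.ρ (cs.simple i)).toLinearMap +
        Finsupp.lsingle w ∘ₗ LinearMap.mulLeft k (1 - (D.a i : A)) ∘ₗ
          (D.ρ (cs.simple i)).toLinearMap
    else Finsupp.lsingle (cs.simple i * w) ∘ₗ (D.ρ (cs.simple i)).toLinearMap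

open scoped Classical in
/-- The right multiplication by the generator `g_s` on the free `A`-module with basis `g_w`. -/
def rightOp (i : B) : Module.End k (W →₀ A) :=
  Finsupp.lsum k fun w =>
    if cs.IsRightDescent w i then
      Finsupp.lsingle (w * cs.simple i) ∘ₗ LinearMap.mulLeft k (D.ρ w (D.a i)) +
        Finsupp.lsingle w ∘ₗ LinearMap.mulLeft k (1 - D.ρ w (D.a i))
    else Finsupp.lsingle (w * cs.simple i)

theorem leftOp_single_of_not {w : W} {i : B} (h : ¬ cs.IsLeftDescent w i) (c : A) :
    D.leftOp i (Finsupp.single w c) =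
      Finsupp.single (cs.simple i * w) (D.ρ (cs.simple i) c) := by
  simp [leftOp, h]

theorem leftOp_single_of {w : W} {i : B} (h : cs.IsLeftDescent w i) (c : A) :
    D.leftOp i (Finsupp.single w c) =
      Finsupp.single (cs.simple i * w) (D.a i * D.ρ (cs.simple i) c) +
        Finsupp.single w ((1 - D.a i) * D.ρ (cs.simple i) c) := by
  simp [leftOp, h]

theorem rightOp_single_of_not {w : W} {i : B} (h : ¬ cs.IsRightDescent w i) (c : A) :
    D.rightOp i (Finsupp.single w c) = Finsupp.single (w * cs.simple i) c := by
  simp [rightOp, h]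

theorem rightOp_single_of {w : W} {i : B} (h : cs.IsRightDescent w i) (c : A) :
    D.rightOp i (Finsupp.single w c) =
      Finsupp.single (w * cs.simple i) (D.ρ w (D.a i) * c) +
        Finsupp.single w ((1 - D.ρ w (D.a i)) * c) := by
  simp [rightOp, h]

theorem rho_mul_simple_a (w : W) (i : B) :
    D.ρ (w * cs.simple i) (D.a i : A) = D.ρ w (D.a i) := by
  rw [map_mul, AlgEquiv.mul_apply, rho_simple_a]

theorem leftOp_smul (i : B) (c : A) (v : W →₀ A) :
    D.leftOp i (c • v) = D.ρ (cs.simple i) c • D.leftOp i v := by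
  induction v using Finsupp.induction_linear with
  | zero => simp
  | add x y hx hy => rw [smul_add, map_add, map_add, hx, hy, smul_add]
  | single w x =>
    rw [Finsupp.smul_single]
    by_cases h : cs.IsLeftDescent w i
    · rw [leftOp_single_of _ h, leftOp_single_of _ h, smul_add, Finsupp.smul_single,
        Finsupp.smul_single, smul_eq_mul, map_mul, smul_eq_mul, smul_eq_mul, mul_left_comm,
        mul_left_comm (1 - (D.a i : A))]
    · rw [leftOp_single_of_not _ h, leftOp_single_of_not _ h, Finsupp.smul_single, smul_eq_mul,
        map_mul, smul_eq_mul]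

variable {D}

/-- Applying `leftOp` twice twists the coefficient by `ρ_s` twice, once more than the term `(1 -
a_s) g_s` does. The hypothesis says precisely that the factor `1 - a_s` cannot see this discrepancy.
-/
theorem leftOp_leftOp
    (hD : ∀ i x, (1 - (D.a i : A)) * D.ρ (cs.simple i) x = (1 - (D.a i : A)) * x)
    (i : B) (v : W →₀ A) :
    D.leftOp i (D.leftOp i v) = (D.a i : A) • v + (1 - (D.a i : A)) • D.leftOp i v := by
  induction v using Finsupp.induction_linear with
  | zero => simp
  | add x y hx hy =>
    simp only [map_add, smul_add, hx, hy]
    abel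
  | single w x =>
    by_cases h : cs.IsLeftDescent w i
    · have h' := cs.isLeftDescent_iff_not_isLeftDescent_mul.mp h
      rw [leftOp_single_of _ h, map_add, leftOp_single_of_not _ h', leftOp_single_of _ h]
      simp only [map_mul, map_sub, map_one, rho_simple_a, rho_simple_rho_simple,
        cs.simple_mul_simple_cancel_left, smul_add, Finsupp.smul_single, smul_eq_mul]
      have e1 : (D.a i : A) * ((1 - D.a i) * x) =
          (1 - D.a i) * (D.a i * D.ρ (cs.simple i) x) := by
        linear_combination (-(D.a i : A)) * hD i x
      have e2 : (1 - (D.a i : A)) * ((1 - D.a i) * x) =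
          (1 - D.a i) * ((1 - D.a i) * D.ρ (cs.simple i) x) := by
        linear_combination (-(1 - (D.a i : A))) * hD i x
      rw [e1, e2]
    · have h' : cs.IsLeftDescent (cs.simple i * w) i := by
        rw [cs.isLeftDescent_iff_not_isLeftDescent_mul, cs.simple_mul_simple_cancel_left]
        exact h
      rw [leftOp_single_of_not _ h, leftOp_single_of _ h']
      simp only [rho_simple_rho_simple, cs.simple_mul_simple_cancel_left, Finsupp.smul_single,
        smul_eq_mul, hD]

/-- This is associativity `g_i (x g_j) = (g_i x) g_j` in disguise. If `s_i w = w s_j`, the left and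
right descents coincide and equivariance gives `ρ_w (a_j) = a_i`. Otherwise neither multiplication
affects the descent on the other side, and the formulas are compared term by term. -/
theorem leftOp_rightOp
    (hD : ∀ i x, (1 - (D.a i : A)) * D.ρ (cs.simple i) x = (1 - (D.a i : A)) * x)
    (i j : B) (v : W →₀ A) :
    D.leftOp i (D.rightOp j v) = D.rightOp j (D.leftOp i v) := by
  induction v using Finsupp.induction_linear with
  | zero => simp
  | add x y hx hy => simp only [map_add, hx, hy]
  | single w x =>
    by_cases he : cs.simple i * w = w * cs.simple j
    · have ha : D.ρ w (D.a j : A) = D.a i := D.equivariant j i w (by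
        rw [← he, mul_inv_cancel_right])
      have ha' : D.ρ (w * cs.simple j) (D.a j : A) = D.a i := by rw [rho_mul_simple_a, ha]
      have hLR : cs.IsLeftDescent w i ↔ cs.IsRightDescent w j := by
        unfold IsLeftDescent IsRightDescent
        rw [he]
      have hLR' : cs.IsLeftDescent (w * cs.simple j) i ↔
          cs.IsRightDescent (w * cs.simple j) j := by
        unfold IsLeftDescent IsRightDescent
        rw [← he, cs.simple_mul_simple_cancel_left, he, cs.simple_mul_simple_cancel_right]
      have hd := cs.isRightDescent_iff_not_isRightDescent_mul (w := w) (i := j)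
      have hc : cs.simple i * (w * cs.simple j) = w := by
        rw [← he, cs.simple_mul_simple_cancel_left]
      by_cases h : cs.IsRightDescent w j
      · have hl := hLR.mpr h
        have h' := hd.mp h
        have hl' := mt hLR'.mp h'
        rw [rightOp_single_of _ h, leftOp_single_of _ hl, map_add, map_add,
          leftOp_single_of_not _ hl', leftOp_single_of _ hl, he, rightOp_single_of_not _ h',
          rightOp_single_of _ h, hc, cs.simple_mul_simple_cancel_right, ha]
        simp only [map_mul, map_sub, map_one, rho_simple_a]
      · have hl := mt hLR.mp h
        have h' : cs.IsRightDescent (w * cs.simple j) j := by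
          by_contra hcc
          exact h (hd.mpr hcc)
        have hl' := hLR'.mpr h'
        rw [rightOp_single_of_not _ h, leftOp_single_of_not _ hl, leftOp_single_of _ hl', he,
          rightOp_single_of _ h', hc, cs.simple_mul_simple_cancel_right, ha']
    · have hl := cs.isLeftDescent_mul_simple_iff he
      have hr := cs.isRightDescent_simple_mul_iff he
      by_cases h1 : cs.IsLeftDescent w i <;> by_cases h2 : cs.IsRightDescent w j
      · rw [rightOp_single_of _ h2, leftOp_single_of _ h1, map_add, map_add,
          leftOp_single_of _ (hl.mpr h1), leftOp_single_of _ h1,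
          rightOp_single_of _ (hr.mpr h2), rightOp_single_of _ h2]
        simp only [map_mul, map_sub, map_one, AlgEquiv.mul_apply, mul_assoc]
        set b := D.ρ w (D.a j : A)
        set y := D.ρ (cs.simple i) x
        -- When both sides are descents, applying the right operator first puts `ρ_i b` next to `1 -
        -- a_i`, and applying it last puts `b`; the hypothesis identifies the two products. No other
        -- case needs it.
        have h3 := hD i b
        have e1 : (D.a i : A) * (D.ρ (cs.simple i) b * y) =
          D.ρ (cs.simple i) b * (D.a i * y) := by ring
        have e2 : (1 - (D.a i : A)) * (D.ρ (cs.simple i) b * y) =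
          b * ((1 - D.a i) * y) := by linear_combination y * h3
        have e3 : (D.a i : A) * ((1 - D.ρ (cs.simple i) b) * y) =
          (1 - D.ρ (cs.simple i) b) * (D.a i * y) := by ring
        have e4 : (1 - (D.a i : A)) * ((1 - D.ρ (cs.simple i) b) * y) =
          (1 - b) * ((1 - D.a i) * y) := by linear_combination (-y) * h3
        rw [e1, e2, e3, e4]
        abel
      · rw [rightOp_single_of_not _ h2, leftOp_single_of _ h1, map_add,
          leftOp_single_of _ (hl.mpr h1), rightOp_single_of_not _ (mt hr.mp h2),
          rightOp_single_of_not _ h2, mul_assoc]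
      · rw [rightOp_single_of _ h2, leftOp_single_of_not _ h1, map_add,
          leftOp_single_of_not _ (mt hl.mp h1), rightOp_single_of _ (hr.mpr h2),
          leftOp_single_of_not _ h1]
        simp only [map_mul, map_sub, map_one, AlgEquiv.mul_apply, mul_assoc]
      · rw [rightOp_single_of_not _ h2, leftOp_single_of_not _ h1,
          leftOp_single_of_not _ (mt hl.mp h1), rightOp_single_of_not _ (mt hr.mp h2), mul_assoc]

variable (D) in
theorem prod_leftOp_smul (ω : List B) (c : A) (v : W →₀ A) :
    (ω.map D.leftOp).prod (c • v) = D.ρ (cs.wordProd ω) c • (ω.map D.leftOp).prod v := by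
  induction ω with
  | nil => simp
  | cons i ω ih =>
    rw [List.map_cons, List.prod_cons, Module.End.mul_apply, Module.End.mul_apply, ih,
      leftOp_smul, wordProd_cons, map_mul, AlgEquiv.mul_apply]

theorem prod_leftOp_rightOp
    (hD : ∀ i x, (1 - (D.a i : A)) * D.ρ (cs.simple i) x = (1 - (D.a i : A)) * x)
    (ω : List B) (j : B) (v : W →₀ A) :
    (ω.map D.leftOp).prod (D.rightOp j v) = D.rightOp j ((ω.map D.leftOp).prod v) := by
  induction ω with
  | nil => simp
  | cons i ω ih =>
    rw [List.map_cons, List.prod_cons, Module.End.mul_apply, Module.End.mul_apply, ih,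
      leftOp_rightOp hD]

variable (D) in
theorem prod_leftOp_single_one {ω : List B} (h : cs.IsReduced ω) :
    (ω.map D.leftOp).prod (Finsupp.single 1 1) = Finsupp.single (cs.wordProd ω) 1 := by
  induction ω with
  | nil => simp
  | cons i ω ih =>
    have h1 : cs.IsReduced ω := by simpa using h.drop 1
    have h2 : ¬ cs.IsLeftDescent (cs.wordProd ω) i := by
      rw [not_isLeftDescent_iff, ← wordProd_cons, h.eq, h1.eq, List.length_cons]
    rw [List.map_cons, List.prod_cons, Module.End.mul_apply, ih h1, leftOp_single_of_not _ h2,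
      map_one, wordProd_cons]

/-- Both products send the basis vector of `1` to that of the common element. Every other basis
vector is obtained from it by right operators, which commute with the products, and general
coefficients follow by semilinearity. Matsumoto's theorem is not needed here; the braid relations
for the operators are an instance. -/
theorem prod_leftOp_eq
    (hD : ∀ i x, (1 - (D.a i : A)) * D.ρ (cs.simple i) x = (1 - (D.a i : A)) * x)
    {ω ω' : List B} (h : cs.IsReduced ω) (h' : cs.IsReduced ω')
    (he : cs.wordProd ω = cs.wordProd ω') :
    (ω.map D.leftOp).prod = (ω'.map D.leftOp).prod := by
  have key : ∀ ν : List B, cs.IsReduced ν →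
      (ω.map D.leftOp).prod (Finsupp.single (cs.wordProd ν) 1) =
        (ω'.map D.leftOp).prod (Finsupp.single (cs.wordProd ν) 1) := by
    intro ν
    induction ν using List.reverseRecOn with
    | nil =>
      intro _
      rw [wordProd_nil, D.prod_leftOp_single_one h, D.prod_leftOp_single_one h', he]
    | append_singleton ν j ih =>
      intro hν
      rw [← List.concat_eq_append] at hν ⊢
      obtain ⟨h1, h2⟩ := cs.isReduced_concat_iff.mp hν
      rw [wordProd_concat, ← D.rightOp_single_of_not h2, prod_leftOp_rightOp hD,
        prod_leftOp_rightOp hD, ih h1]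
  refine LinearMap.ext fun v => ?_
  induction v using Finsupp.induction_linear with
  | zero => simp
  | add x y hx hy => rw [map_add, map_add, hx, hy]
  | single w x =>
    obtain ⟨ν, hν, rfl⟩ := cs.exists_isReduced w
    have : Finsupp.single (cs.wordProd ν) x = x • Finsupp.single (cs.wordProd ν) (1 : A) := by
      simp
    rw [this, prod_leftOp_smul, prod_leftOp_smul, key ν hν, he]

variable (D) in
theorem rho_simple_a_inv (i : B) :
    D.ρ (cs.simple i) (((D.a i)⁻¹ : Aˣ) : A) = ((D.a i)⁻¹ : Aˣ) := by
  have h : D.ρ (cs.simple i) (((D.a i)⁻¹ : Aˣ) : A) * D.a i = 1 := by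
    nth_rewrite 1 [← D.rho_simple_a i]
    rw [← map_mul, Units.inv_mul, map_one]
  exact (Units.inv_eq_of_mul_eq_one_left h).symm

variable (D) in
/-- The invertible operator of left multiplication by `g_s`. -/
def leftUnit
    (hD : ∀ i x, (1 - (D.a i : A)) * D.ρ (cs.simple i) x = (1 - (D.a i : A)) * x)
    (i : B) : (Module.End k (W →₀ A))ˣ where
  val := D.leftOp i
  inv := Algebra.lsmul k k (W →₀ A) (((D.a i)⁻¹ : Aˣ) : A) *
    (D.leftOp i - Algebra.lsmul k k (W →₀ A) (1 - (D.a i : A)))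
  val_inv := by
    refine LinearMap.ext fun v => ?_
    have h1 : D.ρ (cs.simple i) (1 - (D.a i : A)) = 1 - D.a i := by
      rw [map_sub, map_one, rho_simple_a]
    simp only [Module.End.mul_apply, LinearMap.sub_apply, Algebra.lsmul_coe, leftOp_smul,
      LinearMap.map_sub, leftOp_leftOp hD, rho_simple_a_inv, h1]
    rw [← smul_sub, add_sub_cancel_right, smul_smul, Units.inv_mul, one_smul, Module.End.one_apply]
  inv_val := by
    refine LinearMap.ext fun v => ?_
    simp only [Module.End.mul_apply, LinearMap.sub_apply, Algebra.lsmul_coe, leftOp_leftOp hD]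
    rw [add_sub_cancel_right, smul_smul, Units.inv_mul, one_smul, Module.End.one_apply]

variable (D) in
/-- The action of the Artin braid group on the free `A`-module with basis `g_w`. -/
def artinRep
    (hD : ∀ i x, (1 - (D.a i : A)) * D.ρ (cs.simple i) x = (1 - (D.a i : A)) * x) :
    M.ArtinGroup →* (Module.End k (W →₀ A))ˣ :=
  PresentedGroup.toGroup (f := D.leftUnit hD) (by
    rintro r ⟨i, j, hM, rfl⟩
    -- For `i = j` the relator is trivially `1`; otherwise both braid words are reduced expressions
    -- of one element.
    by_cases hij : i = j
    · subst hij
      simp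
    have h : ∀ ω : List B, ((FreeGroup.lift (D.leftUnit hD) ((ω.map FreeGroup.of).prod) :
        (Module.End k (W →₀ A))ˣ) : Module.End k (W →₀ A)) = (ω.map D.leftOp).prod := by
      intro ω
      rw [map_list_prod, List.map_map, ← Units.coeHom_apply, map_list_prod, List.map_map]
      congr 1
    rw [map_mul, map_inv, mul_inv_eq_one]
    refine Units.ext ?_
    rw [h, h]
    refine prod_leftOp_eq hD (cs.isReduced_alternatingWord hij (Or.inr le_rfl))
      (cs.isReduced_alternatingWord (Ne.symm hij) (Or.inr le_rfl)) (cs.wordProd_braidWord_eq i j))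

theorem artinRep_artinGenerator
    (hD : ∀ i x, (1 - (D.a i : A)) * D.ρ (cs.simple i) x = (1 - (D.a i : A)) * x) (i : B) :
    (D.artinRep hD (M.artinGenerator i) : Module.End k (W →₀ A)) = D.leftOp i :=
  congrArg Units.val (PresentedGroup.toGroup.of _)

theorem artinRep_smul
    (hD : ∀ i x, (1 - (D.a i : A)) * D.ρ (cs.simple i) x = (1 - (D.a i : A)) * x)
    (g : M.ArtinGroup) (c : A) (v : W →₀ A) :
    (D.artinRep hD g : Module.End k (W →₀ A)) (c • v) =
      D.ρ (cs.artinProj g) c • (D.artinRep hD g : Module.End k (W →₀ A)) v := by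
  -- Semilinearity is preserved by products and inverses, so it need only be checked on the
  -- generators.
  let H : Subgroup M.ArtinGroup :=
    { carrier := {g | ∀ (c : A) (v : W →₀ A),
        (D.artinRep hD g : Module.End k (W →₀ A)) (c • v) =
          D.ρ (cs.artinProj g) c • (D.artinRep hD g : Module.End k (W →₀ A)) v}
      one_mem' := fun c v => by simp
      mul_mem' := fun {g h} hg hh c v => by
        rw [map_mul, Units.val_mul, Module.End.mul_apply, Module.End.mul_apply, hh, hg, map_mul,
          map_mul, AlgEquiv.mul_apply]
      inv_mem' := fun {g} hg c v => by
        have hinv : ∀ x, (D.artinRep hD g⁻¹ : Module.End k (W →₀ A))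
            ((D.artinRep hD g : Module.End k (W →₀ A)) x) = x := fun x => by
          rw [← Module.End.mul_apply, ← Units.val_mul, ← map_mul, inv_mul_cancel, map_one,
            Units.val_one, Module.End.one_apply]
        have hinv' : ∀ x, (D.artinRep hD g : Module.End k (W →₀ A))
            ((D.artinRep hD g⁻¹ : Module.End k (W →₀ A)) x) = x := fun x => by
          rw [← Module.End.mul_apply, ← Units.val_mul, ← map_mul, mul_inv_cancel, map_one,
            Units.val_one, Module.End.one_apply]
        have h1 : D.ρ (cs.artinProj g) (D.ρ (cs.artinProj g⁻¹) c) = c := by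
          rw [← AlgEquiv.mul_apply, ← map_mul, ← map_mul, mul_inv_cancel, map_one, map_one,
            AlgEquiv.one_apply]
        rw [← hinv (D.ρ (cs.artinProj g⁻¹) c • _), hg, h1, hinv'] }
  exact PresentedGroup.generated_by _ H (fun i c v => by
    have h1 := artinRep_artinGenerator hD i
    have h2 := cs.artinProj_artinGenerator i
    rw [CoxeterMatrix.artinGenerator] at h1 h2
    rw [h1, h2, leftOp_smul]) g c v

variable (D) in
/-- The representation of the semidirect product on the free `A`-module with basis `g_w`. -/
def semidirectRep
    (hD : ∀ i x, (1 - (D.a i : A)) * D.ρ (cs.simple i) x = (1 - (D.a i : A)) * x) :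
    D.SemidirectProduct →ₐ[k] Module.End k (W →₀ A) :=
  SkewMonoidAlgebra.liftNCAlgHom (Algebra.lsmul k k (W →₀ A))
    (((Units.coeHom _).comp (D.artinRep hD)).comp D.toBraidGroup.symm.toMonoidHom)
    (fun {x y} => LinearMap.ext fun v =>
      (artinRep_smul hD (D.toBraidGroup.symm y) x v).symm)

theorem semidirectRep_single
    (hD : ∀ i x, (1 - (D.a i : A)) * D.ρ (cs.simple i) x = (1 - (D.a i : A)) * x)
    (g : D.BraidGroup) (c : A) :
    D.semidirectRep hD (SkewMonoidAlgebra.single g c) =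
      Algebra.lsmul k k (W →₀ A) c * D.artinRep hD (D.toBraidGroup.symm g) :=
  SkewMonoidAlgebra.liftNC_single _ _ _ _

theorem semidirectRep_inclA
    (hD : ∀ i x, (1 - (D.a i : A)) * D.ρ (cs.simple i) x = (1 - (D.a i : A)) * x) (c : A) :
    D.semidirectRep hD (D.inclA c) = Algebra.lsmul k k (W →₀ A) c := by
  rw [inclA, semidirectRep_single, map_one, map_one, Units.val_one, mul_one]

theorem semidirectRep_inclB
    (hD : ∀ i x, (1 - (D.a i : A)) * D.ρ (cs.simple i) x = (1 - (D.a i : A)) * x)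
    (g : M.ArtinGroup) :
    D.semidirectRep hD (D.inclB g) = D.artinRep hD g := by
  rw [inclB, semidirectRep_single, map_one, one_mul, MulEquiv.symm_apply_apply]

variable (D) in
/-- The representation of the Marin algebra on the free `A`-module with basis `g_w`. -/
def rep
    (hD : ∀ i x, (1 - (D.a i : A)) * D.ρ (cs.simple i) x = (1 - (D.a i : A)) * x) :
    D.Alg →ₐ[k] Module.End k (W →₀ A) :=
  RingQuot.liftAlgHom k ⟨D.semidirectRep hD, by
    rintro _ _ ⟨i⟩
    rw [map_pow, map_add, map_mul, semidirectRep_inclA, semidirectRep_inclA, semidirectRep_inclB,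
      artinRep_artinGenerator, pow_two]
    exact LinearMap.ext fun v => leftOp_leftOp hD i v⟩

theorem rep_proj
    (hD : ∀ i x, (1 - (D.a i : A)) * D.ρ (cs.simple i) x = (1 - (D.a i : A)) * x)
    (x : D.SemidirectProduct) : D.rep hD (D.proj x) = D.semidirectRep hD x :=
  RingQuot.liftAlgHom_mkAlgHom_apply k _ _ _

theorem artinRep_artinSection
    (hD : ∀ i x, (1 - (D.a i : A)) * D.ρ (cs.simple i) x = (1 - (D.a i : A)) * x) (w : W) :
    (D.artinRep hD (cs.artinSection w) : Module.End k (W →₀ A)) (Finsupp.single 1 1) =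
      Finsupp.single w 1 := by
  obtain ⟨ω, hω, rfl⟩ := cs.exists_isReduced w
  rw [cs.artinSection_wordProd hω, ← D.prod_leftOp_single_one hω, map_list_prod, List.map_map,
    ← Units.coeHom_apply, map_list_prod, List.map_map]
  congr 2

/-- Evaluation at the basis vector of `1` is a left inverse of the spanning map, whence the linear
independence of the `c_i g_w`. -/
theorem rep_coeff_mul_g
    (hD : ∀ i x, (1 - (D.a i : A)) * D.ρ (cs.simple i) x = (1 - (D.a i : A)) * x)
    (c : A) (w : W) :
    D.rep hD (D.coeff c * D.g w) (Finsupp.single 1 1) = Finsupp.single w c := by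
  rw [map_mul, coeff, g, rep_proj, rep_proj, semidirectRep_inclA, semidirectRep_inclB,
    Module.End.mul_apply, artinRep_artinSection]
  simp

/-! ### The standard basis of a Marin algebra -/

variable (D)

theorem inclA_mul (c c' : A) : D.inclA (c * c') = D.inclA c * D.inclA c' := by
  simp [inclA, SkewMonoidAlgebra.single_mul_single]

theorem inclB_one : D.inclB 1 = 1 := by
  rw [inclB, map_one, SkewMonoidAlgebra.one_def]

theorem inclB_mul (g h : M.ArtinGroup) : D.inclB (g * h) = D.inclB g * D.inclB h := by
  simp [inclB, SkewMonoidAlgebra.single_mul_single]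

theorem inclB_mul_inclA (g : M.ArtinGroup) (c : A) :
    D.inclB g * D.inclA c = D.inclA (D.ρ (cs.artinProj g) c) * D.inclB g := by
  simp [inclB, inclA, SkewMonoidAlgebra.single_mul_single, braidGroup_smul_def]

theorem single_eq_inclA_mul_inclB (g : D.BraidGroup) (c : A) :
    SkewMonoidAlgebra.single g c = D.inclA c * D.inclB (D.toBraidGroup.symm g) := by
  simp [inclB, inclA, SkewMonoidAlgebra.single_mul_single]

/-- The inclusion of `A`, as a linear map. -/
def coeffₗ : A →ₗ[k] D.Alg :=
  D.proj.toLinearMap ∘ₗ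
    { toFun := D.inclA
      map_add' := fun _ _ => SkewMonoidAlgebra.single_add _ _ _
      map_smul' := fun _ _ => (SkewMonoidAlgebra.smul_single _ _ _).symm }

theorem coeff_mul (c c' : A) : D.coeff (c * c') = D.coeff c * D.coeff c' := by
  rw [coeff, inclA_mul, map_mul, coeff, coeff]

theorem coeff_one : D.coeff 1 = 1 := by
  rw [coeff, ← map_one D.proj]
  rfl

theorem quadratic (i : B) :
    D.proj (D.inclB (M.artinGenerator i)) * D.proj (D.inclB (M.artinGenerator i)) =
      D.coeff (D.a i) + D.coeff (1 - D.a i) * D.proj (D.inclB (M.artinGenerator i)) := by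
  rw [← pow_two, ← map_pow, coeff, coeff, ← map_mul, ← map_add]
  exact RingQuot.mkAlgHom_rel k (Rel.quadratic i)

theorem proj_inclB_mul_coeff (g : M.ArtinGroup) (c : A) :
    D.proj (D.inclB g) * D.coeff c =
      D.coeff (D.ρ (cs.artinProj g) c) * D.proj (D.inclB g) := by
  rw [coeff, coeff, ← map_mul, inclB_mul_inclA, map_mul]

theorem g_one : D.g 1 = 1 := by
  rw [g, artinSection_one, inclB_one, map_one]

theorem g_simple_mul {w : W} {i : B} (h : ¬ cs.IsLeftDescent w i) :
    D.g (cs.simple i * w) = D.proj (D.inclB (M.artinGenerator i)) * D.g w := by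
  rw [g, cs.artinSection_simple_mul h, inclB_mul, map_mul, g]

/-- The linear map that takes the element `w` of the basis of the free module to `g_w`. -/
def fromFree : (W →₀ A) →ₗ[k] D.Alg :=
  Finsupp.lsum k fun w => LinearMap.mulRight k (D.g w) ∘ₗ D.coeffₗ

theorem fromFree_single (w : W) (c : A) :
    D.fromFree (Finsupp.single w c) = D.coeff c * D.g w := by
  change Finsupp.sum _ _ = _
  rw [Finsupp.sum_single_index (by simp)]
  rfl

theorem coeff_mul_mem_range (c : A) {x : D.Alg} (hx : x ∈ LinearMap.range D.fromFree) :
    D.coeff c * x ∈ LinearMap.range D.fromFree := by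
  obtain ⟨v, rfl⟩ := hx
  refine ⟨c • v, ?_⟩
  induction v using Finsupp.induction_linear with
  | zero => simp
  | add x y hx hy => rw [smul_add, map_add, map_add, mul_add, hx, hy]
  | single w y =>
    rw [Finsupp.smul_single, fromFree_single, fromFree_single, smul_eq_mul, coeff_mul, mul_assoc]

/-- After moving the coefficient to the left, only `g_i g_w` matters. If `i` is a left descent, then
`g_w = g_i g_{s_i w}` and the quadratic relation applies; otherwise the product is `g_{s_i w}`. -/
theorem generator_mul_mem_range (i : B) {x : D.Alg} (hx : x ∈ LinearMap.range D.fromFree) :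
    D.proj (D.inclB (M.artinGenerator i)) * x ∈ LinearMap.range D.fromFree := by
  have hg : ∀ w, D.g w ∈ LinearMap.range D.fromFree := fun w =>
    ⟨Finsupp.single w 1, by rw [fromFree_single, coeff_one, one_mul]⟩
  obtain ⟨v, rfl⟩ := hx
  induction v using Finsupp.induction_linear with
  | zero => simp
  | add x y hx hy => rw [map_add, mul_add]; exact add_mem hx hy
  | single w y =>
    rw [fromFree_single, ← mul_assoc, proj_inclB_mul_coeff, mul_assoc]
    apply coeff_mul_mem_range
    by_cases h : cs.IsLeftDescent w i
    · have h' := cs.isLeftDescent_iff_not_isLeftDescent_mul.mp h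
      have e := D.g_simple_mul h'
      rw [cs.simple_mul_simple_cancel_left] at e
      have : D.proj (D.inclB (M.artinGenerator i)) * D.g w =
          D.coeff (D.a i) * D.g (cs.simple i * w) + D.coeff (1 - D.a i) * D.g w := by
        rw [e, ← mul_assoc, quadratic, add_mul, mul_assoc]
      rw [this]
      exact add_mem (D.coeff_mul_mem_range _ (hg _)) (D.coeff_mul_mem_range _ (hg _))
    · rw [← D.g_simple_mul h]
      exact hg _

/-- Solving `g_s (g_s - (1 - a_s)) = a_s` for the inverse, which is possible because `a_s` is a unit
fixed by `ρ_s`. It reduces stability of the span under the braid group to stability under the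
generators and `A`. -/
theorem proj_inclB_inv (i : B) :
    D.proj (D.inclB (M.artinGenerator i)⁻¹) =
      D.coeff ((D.a i)⁻¹ : Aˣ) *
        (D.proj (D.inclB (M.artinGenerator i)) - D.coeff (1 - D.a i)) := by
  set T := D.proj (D.inclB (M.artinGenerator i)) with hT
  have h1 : D.proj (D.inclB (M.artinGenerator i)⁻¹) * T = 1 := by
    rw [hT, ← map_mul, ← inclB_mul, inv_mul_cancel, inclB_one, map_one]
  have hc : ∀ c : A, T * D.coeff c = D.coeff (D.ρ (cs.simple i) c) * T := fun c => by
    rw [hT, proj_inclB_mul_coeff, artinProj_artinGenerator]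
  have h2 : T * (D.coeff ((D.a i)⁻¹ : Aˣ) * (T - D.coeff (1 - D.a i))) = 1 := by
    rw [← mul_assoc, hc, rho_simple_a_inv, mul_assoc, mul_sub, hc, map_sub, map_one,
      rho_simple_a, quadratic, add_sub_cancel_right, ← coeff_mul, Units.inv_mul, coeff_one]
  rw [← mul_one (D.proj (D.inclB (M.artinGenerator i)⁻¹)), ← h2, ← mul_assoc, h1, one_mul]

theorem proj_inclB_mul_mem_range (g : M.ArtinGroup) {x : D.Alg}
    (hx : x ∈ LinearMap.range D.fromFree) :
    D.proj (D.inclB g) * x ∈ LinearMap.range D.fromFree := by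
  have hg : g ∈ Subgroup.closure (Set.range (PresentedGroup.of (rels := M.braidRelations))) := by
    rw [PresentedGroup.closure_range_of]
    trivial
  induction hg using Subgroup.closure_induction'' generalizing x with
  | mem _ h =>
    obtain ⟨i, rfl⟩ := h
    exact D.generator_mul_mem_range i hx
  | inv_mem _ h =>
    obtain ⟨i, rfl⟩ := h
    have := D.proj_inclB_inv i
    rw [CoxeterMatrix.artinGenerator] at this
    rw [this, mul_assoc, sub_mul]
    exact D.coeff_mul_mem_range _
      (sub_mem (D.generator_mul_mem_range i hx) (D.coeff_mul_mem_range _ hx))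
  | one => rwa [inclB_one, map_one, one_mul]
  | mul g h _ _ hg hh =>
    rw [inclB_mul, map_mul, mul_assoc]
    exact hg (hh hx)

theorem fromFree_surjective : Function.Surjective D.fromFree := by
  rw [← LinearMap.range_eq_top, eq_top_iff]
  rintro x -
  obtain ⟨y, rfl⟩ : ∃ y, D.proj y = x := RingQuot.mkAlgHom_surjective k D.Rel x
  induction y using SkewMonoidAlgebra.induction_on with
  | zero => rw [map_zero]; exact zero_mem _
  | add f g hf hg => rw [map_add]; exact add_mem hf hg
  | single g c =>
    rw [single_eq_inclA_mul_inclB, map_mul]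
    refine D.coeff_mul_mem_range _ ?_
    rw [← mul_one (D.proj (D.inclB _))]
    exact D.proj_inclB_mul_mem_range _
      ⟨Finsupp.single 1 1, by rw [fromFree_single, coeff_one, g_one, one_mul]⟩

variable {D}

theorem fromFree_injective
    (hD : ∀ i x, (1 - (D.a i : A)) * D.ρ (cs.simple i) x = (1 - (D.a i : A)) * x) :
    Function.Injective D.fromFree := by
  have h : Function.LeftInverse (fun x => D.rep hD x (Finsupp.single 1 1)) D.fromFree := by
    intro v
    induction v using Finsupp.induction_linear with
    | zero => simp
    | add x y hx hy =>
      dsimp only at hx hy ⊢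
      rw [map_add, map_add, LinearMap.add_apply, hx, hy]
    | single w c =>
      dsimp only
      rw [fromFree_single, rep_coeff_mul_g]
  exact h.injective

variable (D) in
/-- The linear equivalence between the free `A`-module with basis `W` and the Marin algebra. -/
def freeEquiv
    (hD : ∀ i x, (1 - (D.a i : A)) * D.ρ (cs.simple i) x = (1 - (D.a i : A)) * x) :
    (W →₀ A) ≃ₗ[k] D.Alg :=
  LinearEquiv.ofBijective D.fromFree ⟨fromFree_injective hD, D.fromFree_surjective⟩

variable (D) in
/-- The standard basis of a Marin algebra attached to a basis of the coefficients. -/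
def algBasis
    (hD : ∀ i x, (1 - (D.a i : A)) * D.ρ (cs.simple i) x = (1 - (D.a i : A)) * x)
    {I : Type*} (c : Module.Basis I k A) : Module.Basis (I × W) k D.Alg :=
  ((Finsupp.basis fun _ : W => c).reindex
    ((Equiv.sigmaEquivProd W I).trans (Equiv.prodComm W I))).map (D.freeEquiv hD)

theorem algBasis_apply
    (hD : ∀ i x, (1 - (D.a i : A)) * D.ρ (cs.simple i) x = (1 - (D.a i : A)) * x)
    {I : Type*} (c : Module.Basis I k A) (i : I) (w : W) :
    D.algBasis hD c (i, w) = D.coeff (c i) * D.g w := by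
  rw [← fromFree_single]
  simp [algBasis, freeEquiv]
  rfl

theorem one_sub_a_mul_rho
    (h : ∀ i : B, (LinearMap.mulLeft k (1 - (D.a i : A)) : Module.End k A) *
        (1 - (D.ρ (cs.simple i)).toLinearMap) = 0) (i : B) (x : A) :
    (1 - (D.a i : A)) * D.ρ (cs.simple i) x = (1 - (D.a i : A)) * x := by
  have := LinearMap.congr_fun (h i) x
  simp only [Module.End.mul_apply, LinearMap.sub_apply, Module.End.one_apply,
    LinearMap.mulLeft_apply, LinearMap.zero_apply, AlgEquiv.toLinearMap_apply, mul_sub] at this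
  exact (sub_eq_zero.mp this).symm

end MarinDatum

namespace CoxeterSystem

variable {B W : Type*} [Group W] {M : CoxeterMatrix B} {cs : CoxeterSystem M W}

/-! ### Root subsystems and reflection subgroups -/

namespace RootSubsystem

theorem neg_mem (Ψ : cs.RootSubsystem) {α : B →₀ ℝ} (h : α ∈ Ψ.carrier) : -α ∈ Ψ.carrier := by
  rw [← cs.reflectionIn_root_self (Ψ.subset_roots h)]
  exact Ψ.reflectionIn_mem α h α h

end RootSubsystem

theorem isReflection_of_geomRep_eq {α : B →₀ ℝ} (hα : α ∈ cs.roots) {t : W}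
    (h : ∀ x, cs.geomRep t x = M.reflectionIn α x) : cs.IsReflection t := by
  obtain ⟨w, i, rfl⟩ := hα
  refine ⟨w, i, cs.geomRep_injective (LinearEquiv.ext fun x => ?_)⟩
  rw [h, reflectionIn_geomRep_simpleRoot]

/-- Roots have norm one, so the scalar has square one. -/
theorem eq_or_eq_neg_of_eq_smul {α β : B →₀ ℝ} (hα : α ∈ cs.roots) (hβ : β ∈ cs.roots) {c : ℝ}
    (h : α = c • β) : α = β ∨ α = -β := by
  have h1 := cs.geomForm_root_self hα
  rw [h] at h1
  simp only [map_smul, LinearMap.smul_apply, cs.geomForm_root_self hβ, smul_eq_mul,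
    mul_one] at h1
  rcases mul_self_eq_one_iff.mp h1 with h2 | h2
  · left; rw [h, h2, one_smul]
  · right; rw [h, h2, neg_smul, one_smul]

theorem finite_roots [Finite W] : cs.roots.Finite := by
  have : Finite B := Finite.of_injective _ cs.simple_injective
  refine (Set.finite_range fun p : W × B => cs.geomRep p.1 (M.simpleRoot p.2)).subset ?_
  rintro _ ⟨w, i, rfl⟩
  exact ⟨(w, i), rfl⟩

namespace RootSubsystem

/-- The reflections in the elements of a root subsystem. -/
def reflections (Ψ : cs.RootSubsystem) : Set W :=
  {t | ∃ α ∈ Ψ.carrier, ∀ x, cs.geomRep t x = M.reflectionIn α x}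

/-- The subgroup generated by the reflections in the elements of a root subsystem. -/
def toSubgroup (Ψ : cs.RootSubsystem) : Subgroup W := Subgroup.closure Ψ.reflections

variable (cs) in
/-- The root subsystem of all roots whose reflection lies in a given subgroup. -/
def ofSubgroup (H : Subgroup W) : cs.RootSubsystem where
  carrier := {α | α ∈ cs.roots ∧ ∃ t ∈ H, ∀ x, cs.geomRep t x = M.reflectionIn α x}
  subset_roots := fun _ h => h.1
  reflectionIn_mem := by
    rintro α ⟨hα, t, ht, htα⟩ β ⟨hβ, r, hr, hrβ⟩
    refine ⟨cs.reflectionIn_mem_roots hα hβ, t * r * t⁻¹,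
      H.mul_mem (H.mul_mem ht hr) (H.inv_mem ht), fun x => ?_⟩
    rw [← htα, map_mul, map_mul, LinearEquiv.mul_apply, LinearEquiv.mul_apply, hrβ,
      geomRep_reflectionIn, ← LinearEquiv.mul_apply, ← map_mul, mul_inv_cancel, map_one,
      LinearEquiv.coe_one, id]

theorem isReflection_of_mem_reflections {Ψ : cs.RootSubsystem} {t : W} (h : t ∈ Ψ.reflections) :
    cs.IsReflection t := by
  obtain ⟨α, hα, h⟩ := h
  exact isReflection_of_geomRep_eq (Ψ.subset_roots hα) h

theorem geomRep_mem_of_mem_toSubgroup {Ψ : cs.RootSubsystem} {w : W} (hw : w ∈ Ψ.toSubgroup)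
    {γ : B →₀ ℝ} (hγ : γ ∈ Ψ.carrier) : cs.geomRep w γ ∈ Ψ.carrier := by
  induction hw using Subgroup.closure_induction'' generalizing γ with
  | mem t h =>
    obtain ⟨α, hα, h⟩ := h
    rw [h]
    exact Ψ.reflectionIn_mem α hα γ hγ
  | inv_mem t h =>
    rw [(isReflection_of_mem_reflections h).inv]
    obtain ⟨α, hα, h⟩ := h
    rw [h]
    exact Ψ.reflectionIn_mem α hα γ hγ
  | one => simpa using hγ
  | mul g h _ _ hg hh =>
    rw [map_mul, LinearEquiv.mul_apply]
    exact hg (hh hγ)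

/-! ### Inversion signs relative to a generic linear form -/

section Sign

variable (Ψ : cs.RootSubsystem) [Finite W] (v : Module.Dual ℝ (B →₀ ℝ))

theorem finite_carrier : Ψ.carrier.Finite := finite_roots.subset Ψ.subset_roots

open scoped Classical in
/-- The elements of a root subsystem on which a linear form is positive. -/
def positive : Finset (B →₀ ℝ) := Ψ.finite_carrier.toFinset.filter fun γ => 0 < v γ

variable {Ψ v} in
theorem mem_positive {γ : B →₀ ℝ} : γ ∈ Ψ.positive v ↔ γ ∈ Ψ.carrier ∧ 0 < v γ := by
  simp [positive]

/-- The parity of the number of positive elements of a root subsystem that `w` makes negative. -/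
def inversionSign (w : W) : SignType := ∏ γ ∈ Ψ.positive v, SignType.sign (v (cs.geomRep w γ))

variable {Ψ v}

/-- Since `h` preserves `Ψ`, sending `γ` to whichever of `hγ` and `-hγ` is positive permutes the
positive elements. Each factor of the sign of `g * h` is then a factor for `g` at the permuted
element times the factor for `h` at `γ`. -/
theorem inversionSign_mul (hv : ∀ γ ∈ Ψ.carrier, v γ ≠ 0) (g : W) {h : W}
    (hh : ∀ γ ∈ Ψ.carrier, cs.geomRep h γ ∈ Ψ.carrier) :
    Ψ.inversionSign v (g * h) = Ψ.inversionSign v g * Ψ.inversionSign v h := by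
  set r : (B →₀ ℝ) → (B →₀ ℝ) := fun γ =>
    if 0 < v (cs.geomRep h γ) then cs.geomRep h γ else -cs.geomRep h γ with hr
  have hneg : ∀ γ ∈ Ψ.positive v, ¬ 0 < v (cs.geomRep h γ) → v (cs.geomRep h γ) < 0 :=
    fun γ hγ h0 => lt_of_le_of_ne (not_lt.mp h0) (hv _ (hh γ (mem_positive.mp hγ).1))
  have hmaps : Set.MapsTo r (Ψ.positive v) (Ψ.positive v) := fun γ hγ => by
    have h1 := hh γ (mem_positive.mp hγ).1
    refine mem_positive.mpr ?_
    by_cases h0 : 0 < v (cs.geomRep h γ)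
    · simp only [hr, h0, if_true]
      exact ⟨h1, trivial⟩
    · simp only [hr, h0, if_false]
      refine ⟨Ψ.neg_mem h1, ?_⟩
      rw [map_neg]
      exact neg_pos.mpr (hneg γ hγ h0)
  have hinj : Set.InjOn r (Ψ.positive v) := fun γ hγ δ hδ he => by
    have hpγ := (mem_positive.mp hγ).2
    have hpδ := (mem_positive.mp hδ).2
    have key : γ = δ ∨ γ = -δ := by
      have h1 : cs.geomRep h γ = cs.geomRep h δ ∨ cs.geomRep h γ = cs.geomRep h (-δ) := by
        rw [map_neg]
        simp only [hr] at he
        split_ifs at he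
        · exact Or.inl he
        · exact Or.inr he
        · exact Or.inr (neg_eq_iff_eq_neg.mp he)
        · exact Or.inl (neg_injective he)
      exact h1.imp (fun e => (cs.geomRep h).injective e) (fun e => (cs.geomRep h).injective e)
    rcases key with e | e
    · exact e
    · rw [e, map_neg] at hpγ
      linarith
  have hsurj := Finset.surjOn_of_injOn_of_card_le r hmaps hinj le_rfl
  have h1 : Ψ.inversionSign v g =
      ∏ γ ∈ Ψ.positive v, SignType.sign (v (cs.geomRep g (r γ))) :=
    (Finset.prod_nbij r hmaps hinj hsurj fun _ _ => rfl).symm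
  rw [h1, inversionSign, inversionSign, ← Finset.prod_mul_distrib]
  refine Finset.prod_congr rfl fun γ hγ => ?_
  rw [map_mul, LinearEquiv.mul_apply]
  by_cases h0 : 0 < v (cs.geomRep h γ)
  · simp only [hr, h0, if_true, sign_pos h0, mul_one]
  · simp only [hr, h0, if_false, sign_neg (hneg γ hγ h0), map_neg, Left.sign_neg]
    simp

theorem inversionSign_one : Ψ.inversionSign v 1 = 1 :=
  Finset.prod_eq_one fun γ hγ => by simpa using sign_pos (mem_positive.mp hγ).2

/-- The positive root `α` of `t` contributes `-1`. The other positive elements made negative by `t`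
are paired by `γ ↦ -tγ`, so they contribute `1` in total. -/
theorem inversionSign_reflection (hv : ∀ γ ∈ Ψ.carrier, v γ ≠ 0) {t : W}
    (ht : t ∈ Ψ.reflections) : Ψ.inversionSign v t = -1 := by
  classical
  have hr : cs.IsReflection t := isReflection_of_mem_reflections ht
  have htt : ∀ x, cs.geomRep t (cs.geomRep t x) = x := fun x => by
    rw [← LinearEquiv.mul_apply, ← map_mul, hr.mul_self, map_one, LinearEquiv.coe_one, id]
  have htΨ : ∀ γ ∈ Ψ.carrier, cs.geomRep t γ ∈ Ψ.carrier := fun γ hγ =>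
    geomRep_mem_of_mem_toSubgroup (Subgroup.subset_closure ht) hγ
  obtain ⟨α, hα, hpos, htα⟩ : ∃ α ∈ Ψ.carrier, 0 < v α ∧
      ∀ x, cs.geomRep t x = M.reflectionIn α x := by
    obtain ⟨α, hα, h⟩ := ht
    rcases lt_or_gt_of_ne (hv α hα) with h0 | h0
    · refine ⟨-α, Ψ.neg_mem hα, by rw [map_neg]; exact neg_pos.mpr h0, fun x => ?_⟩
      rw [h, M.reflectionIn_apply, M.reflectionIn_apply]
      simp
    · exact ⟨α, hα, h0, h⟩
  have hmem : α ∈ Ψ.positive v := mem_positive.mpr ⟨hα, hpos⟩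
  have h1 : SignType.sign (v (cs.geomRep t α)) = -1 := by
    rw [htα, cs.reflectionIn_root_self (Ψ.subset_roots hα), map_neg]
    exact sign_neg (neg_neg_of_pos hpos)
  rw [inversionSign, ← Finset.mul_prod_erase _ _ hmem, h1]
  have hneg : ∀ γ ∈ (Ψ.positive v).erase α, ¬ 0 < v (cs.geomRep t γ) →
      v (cs.geomRep t γ) < 0 := fun γ hγ h0 =>
    lt_of_le_of_ne (not_lt.mp h0)
      (hv _ (htΨ γ (mem_positive.mp (Finset.mem_of_mem_erase hγ)).1))
  -- A fixed point of the pairing satisfies `tγ = -γ`, so it is proportional to `α`; being positive,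
  -- it would be `α` itself.
  have hfix : ∀ γ ∈ (Ψ.positive v).erase α, -cs.geomRep t γ ≠ γ := by
    intro γ hγ he
    obtain ⟨hne, hγ⟩ := Finset.mem_erase.mp hγ
    obtain ⟨hγΨ, hγp⟩ := mem_positive.mp hγ
    have h2 : γ = M.geomForm α γ • α := by
      rw [htα, M.reflectionIn_apply] at he
      have h3 : (2 : ℝ) • γ = (2 : ℝ) • (M.geomForm α γ • α) := by
        rw [two_smul, smul_smul]
        nth_rewrite 1 [← he]
        abel
      exact smul_right_injective _ (two_ne_zero' ℝ) h3
    rcases eq_or_eq_neg_of_eq_smul (Ψ.subset_roots hγΨ) (Ψ.subset_roots hα) h2 with h3 | h3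
    · exact hne h3
    · rw [h3, map_neg] at hγp
      linarith
  -- The involution fixes the elements that stay positive, whose factor is `1`, and applies `γ ↦
  -- -tγ` to the others.
  have h2 : ∏ γ ∈ (Ψ.positive v).erase α, SignType.sign (v (cs.geomRep t γ)) = 1 := by
    refine Finset.prod_involution
      (fun γ _ => if 0 < v (cs.geomRep t γ) then γ else -cs.geomRep t γ)
      (fun γ hγ => ?_) (fun γ hγ h3 => ?_) (fun γ hγ => ?_) (fun γ hγ => ?_)
    · by_cases h0 : 0 < v (cs.geomRep t γ)
      · simp [h0, sign_pos h0]
      · have hp := (mem_positive.mp (Finset.mem_of_mem_erase hγ)).2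
        simp only [h0, if_false, sign_neg (hneg γ hγ h0), map_neg, htt, Left.sign_neg,
          sign_pos hp]
        rfl
    · have h0 : ¬ 0 < v (cs.geomRep t γ) := fun h0 => h3 (sign_pos h0)
      simp only [h0, if_false]
      exact hfix γ hγ
    · by_cases h0 : 0 < v (cs.geomRep t γ)
      · simpa only [h0, if_true] using hγ
      · simp only [h0, if_false]
        obtain ⟨hne, hγ'⟩ := Finset.mem_erase.mp hγ
        obtain ⟨hγΨ, hγp⟩ := mem_positive.mp hγ'
        refine Finset.mem_erase.mpr ⟨fun he => hne ?_, mem_positive.mpr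
          ⟨Ψ.neg_mem (htΨ γ hγΨ), ?_⟩⟩
        · have h4 := congrArg (fun x => -cs.geomRep t x) he
          simp only [map_neg, htt, neg_neg] at h4
          rw [h4, htα, cs.reflectionIn_root_self (Ψ.subset_roots hα), neg_neg]
        · rw [map_neg]
          exact neg_pos.mpr (hneg γ hγ h0)
    · by_cases h0 : 0 < v (cs.geomRep t γ)
      · simp only [h0, if_true]
      · have hp := (mem_positive.mp (Finset.mem_of_mem_erase hγ)).2
        have h5 : ¬ 0 < v (cs.geomRep t (-cs.geomRep t γ)) := by
          rw [map_neg, htt, map_neg]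
          linarith
        simp only [h0, if_false, h5]
        rw [map_neg, htt, neg_neg]
  rw [h2, mul_one]

/-- Both sides are multiplicative on the reflection subgroup and equal `-1` on its generating
reflections, since reflections have odd length. In particular the left side does not depend on the
form `v`. -/
theorem inversionSign_eq_neg_one_pow (hv : ∀ γ ∈ Ψ.carrier, v γ ≠ 0) {w : W}
    (hw : w ∈ Ψ.toSubgroup) : Ψ.inversionSign v w = (-1) ^ cs.length w := by
  induction hw using Subgroup.closure_induction'' with
  | mem t h =>
    rw [inversionSign_reflection hv h, (isReflection_of_mem_reflections h).odd_length.neg_one_pow]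
  | inv_mem t h =>
    rw [(isReflection_of_mem_reflections h).inv, inversionSign_reflection hv h,
      (isReflection_of_mem_reflections h).odd_length.neg_one_pow]
  | one => rw [inversionSign_one, length_one, pow_zero]
  | mul g h _ hh ihg ihh =>
    rw [inversionSign_mul hv g fun γ hγ => geomRep_mem_of_mem_toSubgroup hh hγ, ihg, ihh,
      ← pow_add, pow_eq_pow_mod (n := 2) (cs.length g + cs.length h) (by decide),
      ← length_mul_mod_two, ← pow_eq_pow_mod _ (by decide)]

end Sign

/-- The substantial half of the correspondence with reflection subgroups: the generated group
contains no reflections beyond those in the elements of `Ψ`. A well-chosen linear form would give a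
further one the sign `1`, against its odd length. -/
theorem mem_of_reflection_mem_toSubgroup [Finite W] {Ψ : cs.RootSubsystem} {β : B →₀ ℝ}
    (hβ : β ∈ cs.roots) {t : W} (ht : t ∈ Ψ.toSubgroup)
    (h : ∀ x, cs.geomRep t x = M.reflectionIn β x) : β ∈ Ψ.carrier := by
  by_contra hβΨ
  have : Finite Ψ.carrier := Ψ.finite_carrier
  obtain ⟨f, hf⟩ := Module.exists_dual_forall_apply_ne_zero (K := ℝ)
    (fun γ : Ψ.carrier => (Submodule.span ℝ {β}).mkQ γ.1) (by
      rintro ⟨γ, hγ⟩ h0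
      rw [Submodule.mkQ_apply, Submodule.Quotient.mk_eq_zero, Submodule.mem_span_singleton] at h0
      obtain ⟨c, hc⟩ := h0
      rcases eq_or_eq_neg_of_eq_smul (Ψ.subset_roots hγ) hβ hc.symm with h1 | h1
      · exact hβΨ (h1 ▸ hγ)
      · exact hβΨ (by simpa [h1] using Ψ.neg_mem hγ))
  set v : Module.Dual ℝ (B →₀ ℝ) := f ∘ₗ (Submodule.span ℝ {β}).mkQ with hvdef
  have hv : ∀ γ ∈ Ψ.carrier, v γ ≠ 0 := fun γ hγ => hf ⟨γ, hγ⟩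
  have hvβ : v β = 0 := by
    rw [hvdef, LinearMap.comp_apply, Submodule.mkQ_apply,
      (Submodule.Quotient.mk_eq_zero _).mpr (Submodule.mem_span_singleton_self β), map_zero]
  -- As `v β = 0`, the reflection in `β` preserves `v` and makes no positive element negative.
  have h1 : Ψ.inversionSign v t = 1 := Finset.prod_eq_one fun γ hγ => by
    rw [h, M.reflectionIn_apply, map_sub, map_smul, hvβ, smul_zero, sub_zero]
    exact sign_pos (mem_positive.mp hγ).2
  rw [inversionSign_eq_neg_one_pow hv ht,
    (isReflection_of_geomRep_eq hβ h).odd_length.neg_one_pow] at h1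
  exact absurd h1 (by decide)

variable (cs) in
/-- Root subsystems correspond to reflection subgroups. -/
def equivReflectionSubgroup [Finite W] : cs.RootSubsystem ≃
    {H : Subgroup W // ∃ T : Set W, (∀ t ∈ T, cs.IsReflection t) ∧ H = Subgroup.closure T} where
  toFun Ψ := ⟨Ψ.toSubgroup, Ψ.reflections, fun _ h => isReflection_of_mem_reflections h, rfl⟩
  invFun H := ofSubgroup cs H.1
  left_inv Ψ := by
    refine le_antisymm' (fun β ⟨hβ, t, ht, h⟩ => mem_of_reflection_mem_toSubgroup hβ ht h)
      fun α hα => ⟨Ψ.subset_roots hα, ?_⟩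
    obtain ⟨w, i, rfl⟩ := Ψ.subset_roots hα
    have h := fun x => (cs.reflectionIn_geomRep_simpleRoot w i x).symm
    exact ⟨_, Subgroup.subset_closure ⟨_, hα, h⟩, h⟩
  right_inv := by
    rintro ⟨H, T, hT, rfl⟩
    refine Subtype.ext (le_antisymm ((Subgroup.closure_le _).mpr ?_)
      (Subgroup.closure_mono fun t ht => ?_))
    · rintro t ⟨α, ⟨-, r, hr, hrα⟩, htα⟩
      have : t = r := cs.geomRep_injective (LinearEquiv.ext fun x => by rw [htα, hrα])
      exact this ▸ hr
    · obtain ⟨w, i, rfl⟩ := hT t ht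
      have h := fun x => (cs.reflectionIn_geomRep_simpleRoot w i x).symm
      exact ⟨_, ⟨⟨w, i, rfl⟩, _, Subgroup.subset_closure ht, h⟩, h⟩

instance [Finite W] : Finite cs.RootSubsystem :=
  Finite.of_equiv _ (equivReflectionSubgroup cs).symm

theorem card_eq_bell [Finite W] : Nat.card cs.RootSubsystem = cs.bell :=
  Nat.card_congr (equivReflectionSubgroup cs)

/-- A root subsystem containing `α_s` is stable under `s`, so it contains `Ψ` exactly when it
contains `s • Ψ`. This is the source of the compatibility condition for Marin's algebra. -/
theorem simple_mul_smul (i : B) (Ψ : cs.RootSubsystem) :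
    simple i * cs.simple i • Ψ = simple i * Ψ := by
  have hm : ∀ Ω : cs.RootSubsystem, M.simpleRoot i ∈ (simple i * Ω).carrier := fun Ω =>
    left_subset_mul _ _ (Or.inl rfl)
  have hs : ∀ (Ω : cs.RootSubsystem), (cs.simple i • Ω).carrier ⊆ (simple i * Ω).carrier := by
    rintro Ω _ ⟨γ, hγ, rfl⟩
    rw [geomRep_simple, M.simpleReflection_apply]
    exact (simple i * Ω).reflectionIn_mem _ (hm Ω) _ (right_subset_mul _ _ hγ)
  refine le_antisymm' (mul_subset (left_subset_mul _ _) (hs Ψ))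
    (mul_subset (left_subset_mul _ _) ?_)
  -- The reverse inclusion is the first one for `s • Ψ`, since `s` is an involution.
  have h := hs (cs.simple i • Ψ)
  rwa [← mul_smul, cs.simple_mul_simple_self, one_smul] at h

end RootSubsystem

end CoxeterSystem

/-! ### Rank formulas and the case of root subsystems -/

namespace MarinDatum

variable {k : Type*} [CommRing k] {B W : Type*} [Group W] {M : CoxeterMatrix B}
  {cs : CoxeterSystem M W} {A : Type*} [CommRing A] [Algebra k A] {D : MarinDatum k cs A}

theorem free_alg [Module.Free k A]
    (hD : ∀ i x, (1 - (D.a i : A)) * D.ρ (cs.simple i) x = (1 - (D.a i : A)) * x) :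
    Module.Free k D.Alg :=
  Module.Free.of_basis (D.algBasis hD (Module.Free.chooseBasis k A))

theorem finite_alg [Module.Finite k A] [Finite W]
    (hD : ∀ i x, (1 - (D.a i : A)) * D.ρ (cs.simple i) x = (1 - (D.a i : A)) * x) :
    Module.Finite k D.Alg :=
  Module.Finite.equiv (D.freeEquiv hD)

theorem finrank_alg [Module.Free k A] [Nontrivial k]
    (hD : ∀ i x, (1 - (D.a i : A)) * D.ρ (cs.simple i) x = (1 - (D.a i : A)) * x) :
    Module.finrank k D.Alg = Nat.card W * Module.finrank k A := by
  have c := Module.Free.chooseBasis k A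
  rw [Module.finrank_eq_nat_card_basis (D.algBasis hD c), Nat.card_prod,
    Module.finrank_eq_nat_card_basis c, mul_comm]

theorem rank_alg {k : Type uk} [CommRing k] {B : Type uB} {W : Type uW}
    [Group W] {M : CoxeterMatrix B} {cs : CoxeterSystem M W} {A : Type uA} [CommRing A]
    [Algebra k A] {D : MarinDatum k cs A} [Module.Free k A] [Nontrivial k]
    (hD : ∀ i x, (1 - (D.a i : A)) * D.ρ (cs.simple i) x = (1 - (D.a i : A)) * x) :
    Cardinal.lift.{uW} (Module.rank k D.Alg) =
      Cardinal.lift.{max uA uB} (Cardinal.mk W) *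
        Cardinal.lift.{max uB uW} (Module.rank k A) := by
  have c := Module.Free.chooseBasis k A
  have h1 := (D.algBasis hD c).mk_eq_rank
  -- `D.Alg` lives in `max uA uB`, so both lifts land in the same universe; they are the same
  -- cardinal written with different universe arguments.
  have h2 : Cardinal.lift.{max uA uW, max uA uB} (Module.rank k D.Alg) =
      Cardinal.lift.{uW, max uA uB} (Module.rank k D.Alg) :=
    Cardinal.inductionOn (Module.rank k D.Alg) fun _ =>
      Cardinal.mk_congr (Equiv.ulift.trans Equiv.ulift.symm)
  rw [Cardinal.mk_prod, c.mk_eq_rank'', h2, Cardinal.lift_mul, Cardinal.lift_lift,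
    Cardinal.lift_lift, mul_comm] at h1
  rw [← h1]
  congr 1
  exact Cardinal.inductionOn (Module.rank k A) fun _ =>
    Cardinal.mk_congr (Equiv.ulift.trans Equiv.ulift.symm)

end MarinDatum

/-- Here `1 - a_s` is the multiple `(1 - u_s) {α_s, -α_s}`, and on the monoid basis the factor
`{α_s, -α_s}` absorbs the action of `s`. -/
theorem CoxeterSystem.marinDatum_one_sub_a_mul_rho {k : Type*} [CommRing k] {B W : Type*}
    [Group W] {M : CoxeterMatrix B} (cs : CoxeterSystem M W) (u : B → kˣ)
    (hu : ∀ (i j : B) (w : W), w * cs.simple i * w⁻¹ = cs.simple j → u i = u j) (i : B)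
    (x : MonoidAlgebra k cs.RootSubsystem) :
    (1 - ((cs.marinDatum u hu).a i : MonoidAlgebra k cs.RootSubsystem)) *
        (cs.marinDatum u hu).ρ (cs.simple i) x =
      (1 - ((cs.marinDatum u hu).a i : MonoidAlgebra k cs.RootSubsystem)) * x := by
  have ha : ((cs.marinDatum u hu).a i : MonoidAlgebra k cs.RootSubsystem) =
      1 + MonoidAlgebra.single (RootSubsystem.simple i) ((u i : k) - 1) := rfl
  rw [ha, sub_add_cancel_left]
  induction x using MonoidAlgebra.induction_linear with
  | zero => simp
  | add x y hx hy => rw [map_add, mul_add, mul_add, hx, hy]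
  | single Ψ r =>
    have hρ : (cs.marinDatum u hu).ρ (cs.simple i) (MonoidAlgebra.single Ψ r) =
        MonoidAlgebra.single (cs.simple i • Ψ) r := by
      simp [marinDatum, MarinDatum.ofMonoid]
    rw [hρ, neg_mul, neg_mul, MonoidAlgebra.single_mul_single, MonoidAlgebra.single_mul_single,
      RootSubsystem.simple_mul_smul]

end

theorem mainTheorem3 {k : Type uk} [CommRing k] {B : Type uB} {W : Type uW}
    [Group W] {M : CoxeterMatrix B} (cs : CoxeterSystem M W) :
    -- the canonical section is given by every reduced expression
    (∀ ω : List B, cs.IsReduced ω →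
      cs.artinSection (cs.wordProd ω) = (ω.map M.artinGenerator).prod) ∧
    -- the general rank formula
    (∀ {A : Type uA} [CommRing A] [Algebra k A] [Module.Free k A] [Module.Finite k A]
      (D : MarinDatum k cs A),
      (∀ i : B, (LinearMap.mulLeft k (1 - (D.a i : A)) : Module.End k A) *
        (1 - (D.ρ (cs.simple i)).toLinearMap) = 0) →
      Module.Free k D.Alg ∧
      (∀ {I : Type uI} (c : Module.Basis I k A),
        ∃ b : Module.Basis (I × W) k D.Alg, ∀ i w, b (i, w) = D.coeff (c i) * D.g w) ∧
      (Nontrivial k → Cardinal.lift.{uW} (Module.rank k D.Alg) =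
        Cardinal.lift.{max uA uB} (Cardinal.mk W) *
          Cardinal.lift.{max uB uW} (Module.rank k A)) ∧
      (Finite W → Module.Finite k D.Alg) ∧
      (Finite W → Nontrivial k →
        Module.finrank k D.Alg = Nat.card W * Module.finrank k A)) ∧
    -- Marin's rank formula
    (∀ (u : B → kˣ)
      (hu : ∀ (i j : B) (w : W), w * cs.simple i * w⁻¹ = cs.simple j → u i = u j),
      Finite W →
      Module.Free k (cs.marinDatum u hu).Alg ∧
      Module.Finite k (cs.marinDatum u hu).Alg ∧
      (Nontrivial k →
        Module.finrank k (cs.marinDatum u hu).Alg = cs.bell * Nat.card W)) := by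
  refine ⟨fun ω hω => cs.artinSection_wordProd hω, ?_, ?_⟩
  · intro A _ _ _ _ D h
    have hD := MarinDatum.one_sub_a_mul_rho h
    exact ⟨MarinDatum.free_alg hD,
      fun c => ⟨D.algBasis hD c, fun i w => MarinDatum.algBasis_apply hD c i w⟩,
      fun _ => MarinDatum.rank_alg hD, fun _ => MarinDatum.finite_alg hD,
      fun _ _ => MarinDatum.finrank_alg hD⟩
  · intro u hu _
    have hD := cs.marinDatum_one_sub_a_mul_rho u hu
    have hf : Module.Finite k (MonoidAlgebra k cs.RootSubsystem) :=
      Module.Finite.of_basis (MonoidAlgebra.basis cs.RootSubsystem k)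
    have hfr : Module.Free k (MonoidAlgebra k cs.RootSubsystem) :=
      Module.Free.of_basis (MonoidAlgebra.basis cs.RootSubsystem k)
    refine ⟨MarinDatum.free_alg hD, MarinDatum.finite_alg hD, fun _ => ?_⟩
    rw [MarinDatum.finrank_alg hD,
      Module.finrank_eq_nat_card_basis (MonoidAlgebra.basis cs.RootSubsystem k),
      CoxeterSystem.RootSubsystem.card_eq_bell, mul_comm]
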